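/- Let $a$, $b$, $c$ and $r$ be positive integers with $r \geq 5$, and assume that $$ ab \;\geq\; 2^r \, r^{\frac{7r}{r-4}} \, c^{\,2+\frac{r^2+r+2}{r(r-4)}}. $$ Then there are at most $3$ pairs $(x,y)$ of positive integers with $\gcd(x,y)=1$ such that $$ 0 < |a x^r - b y^r| \leq c . $$ -/

import Mathlib

/-! For a solution put u = a^(1/r) x and v = b^(1/r) y, so that W = u^r / v^r is close to 1, and let
S be the smaller of u^r and v^r, with s = S^(1/r). The diagonal Padé approximants to W^(1/r) at W =
1, cleared of denominators, give integers P and Q with Pv - Qu tiny. For a second solution (x', y')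
the integer P y x' - Q x y', multiplied by (ab)^(1/r), equals P v u' - Q u v' = (Pv - Qu) v' + P v
(u' - v'), and both terms are small (`abs_padeForm_pair_le`). If the integer is nonzero, this is at
least (ab)^(1/r) in absolute value.

The remainder is explicit: with W = e^(rt), P - e^t Q is an exponential sum with frequencies rk and
rk + 1, k ≤ n, and is a multiple of the divided difference of e ↦ exp(et) at these 2n + 2 nodes.
This gives order of vanishing 2n + 1 and a clean bound.

Degree n = 0 yields the gap principle S^4 ≤ c^2 S' (`pairSize_pow_four_le`). Since S^2 ≥ ab/2 for
every solution, two gaps make the third size at least K^7, where K = 16 r^2 c^2. A fourth solution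
is then impossible: of two consecutive forms at least one is nonzero (`padePairing_ne_zero_or`), and
nonzero forms bootstrap to S^(n+1) ≤ 16 c s s' K^n for arbitrarily large n, against S ≥ 2K
(`false_of_le_padeBound`). -/

/-! ### Integrality of products over arithmetic progressions -/

open Finset in
-- Checked one prime power at a time. If p divides r, the factor r^k suffices because v_p(k!) ≤ k.
-- Otherwise r is invertible modulo p^m, and scaling by its inverse turns the progression into k
-- consecutive integers.
theorem factorial_dvd_pow_mul_prod_arith (r k : ℕ) (s : ℤ) :
    (k.factorial : ℤ) ∣ (r : ℤ) ^ k * ∏ j ∈ range k, (s + r * j) := by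
  rw [← dvd_abs, Int.abs_eq_natAbs, Int.natCast_dvd_natCast, Nat.dvd_iff_prime_pow_dvd_dvd]
  intro p m hp hpm
  rw [← Int.natCast_dvd_natCast, Int.natCast_natAbs, dvd_abs]
  have := Fact.mk hp
  by_cases hpr : p ∣ r
  · have hm : m ≤ k := ((padicValNat_dvd_iff_le k.factorial_ne_zero).1 hpm).trans
      (padicValNat_factorial_le p k)
    exact Dvd.dvd.mul_right (by exact_mod_cast (pow_dvd_pow p hm).trans (pow_dvd_pow_of_dvd hpr k)) _
  · have hcop : IsCoprime (r : ℤ) ((p ^ m : ℕ) : ℤ) :=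
      Nat.isCoprime_iff_coprime.2 (((Nat.Prime.coprime_iff_not_dvd hp).2 hpr).symm.pow_right m)
    obtain ⟨r', q, h⟩ := hcop
    apply Dvd.dvd.mul_left
    have hr' : IsCoprime ((p ^ m : ℕ) : ℤ) r' := ⟨q, r, by linear_combination h⟩
    refine (hr'.pow_right (n := k)).dvd_of_dvd_mul_left ?_
    have hmod : r' ^ k * ∏ j ∈ range k, (s + r * j) ≡ ∏ j ∈ range k, (r' * s + j)
        [ZMOD ((p ^ m : ℕ) : ℤ)] := by
      have : r' ^ k = ∏ j ∈ range k, r' := by simp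
      rw [this, ← prod_mul_distrib]
      refine Int.ModEq.prod fun j _ => ?_
      rw [Int.modEq_iff_dvd]
      exact ⟨q * j, by linear_combination (-(j : ℤ)) * h⟩
    refine hmod.dvd_iff.2 ?_
    exact (Int.natCast_dvd_natCast.2 hpm).trans (Nat.factorial_coe_dvd_prod k (r' * s))

/-! ### Divided differences of the exponential function -/

open Finset Lagrange Real

/-- This is the divided difference of the constant 1, that is, the top coefficient of its
interpolation polynomial. -/
theorem sum_nodalWeight_eq_zero {ι F : Type*} [DecidableEq ι] [Field F] {s : Finset ι} {v : ι → F}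
    (hv : Set.InjOn v s) (hs : 2 ≤ #s) : ∑ i ∈ s, nodalWeight s v i = 0 := by
  have h := coeff_eq_sum hv (P := 1) (by
    rw [Polynomial.degree_one]; exact_mod_cast (by omega : 0 < #s))
  rw [Polynomial.coeff_one, if_neg (by omega)] at h
  rw [h]
  refine sum_congr rfl fun i _ => ?_
  simp [nodalWeight, Finset.prod_inv_distrib]

/-- The divided difference of `e ↦ exp (e * t)` over the nodes `v i`, `i ∈ s`. -/
noncomputable def expDividedDiff {ι : Type*} [DecidableEq ι] (s : Finset ι) (v : ι → ℝ) (t : ℝ) :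
    ℝ := ∑ i ∈ s, nodalWeight s v i * exp (v i * t)

theorem expDividedDiff_zero {ι : Type*} [DecidableEq ι] {s : Finset ι} {v : ι → ℝ}
    (hv : Set.InjOn v s) (hs : 2 ≤ #s) : expDividedDiff s v 0 = 0 := by
  simpa [expDividedDiff] using sum_nodalWeight_eq_zero hv hs

/-- Differentiation kills the term of node i and multiplies each other weight by v j - v i, which is
exactly the effect of removing that node. This drives the induction on the number of nodes. -/
theorem hasDerivAt_exp_mul_expDividedDiff {ι : Type*} [DecidableEq ι] {s : Finset ι} {v : ι → ℝ}
    (hv : Set.InjOn v s) {i : ι} (hi : i ∈ s) (t : ℝ) :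
    HasDerivAt (fun t => exp (-v i * t) * expDividedDiff s v t)
      (exp (-v i * t) * expDividedDiff (s.erase i) v t) t := by
  have h1 : HasDerivAt (fun t => ∑ j ∈ s, nodalWeight s v j * exp ((v j - v i) * t))
      (∑ j ∈ s, nodalWeight s v j * (exp ((v j - v i) * t) * (v j - v i))) t := by
    refine HasDerivAt.fun_sum fun j _ => ?_
    refine HasDerivAt.const_mul _ ?_
    simpa using (((hasDerivAt_id t).const_mul (v j - v i)).exp)
  convert h1 using 1
  · funext t
    simp only [expDividedDiff, mul_sum]
    refine sum_congr rfl fun j _ => ?_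
    rw [sub_mul, sub_eq_neg_add, exp_add, neg_mul]
    ring
  · rw [← add_sum_erase s _ hi]
    simp only [expDividedDiff, mul_sum, sub_self, mul_zero, zero_add]
    refine sum_congr rfl fun j hj => ?_
    have hji : j ≠ i := (mem_erase.1 hj).1
    have hjs := (mem_erase.1 hj).2
    have hne : v j - v i ≠ 0 := sub_ne_zero.2 fun h => hji (hv hjs hi h)
    have : nodalWeight (s.erase i) v j = nodalWeight s v j * (v j - v i) := by
      have hmem : i ∈ s.erase j := mem_erase.2 ⟨hji.symm, hi⟩
      rw [nodalWeight, nodalWeight, ← mul_prod_erase (s.erase j) _ hmem, erase_right_comm]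
      field_simp
    rw [this, sub_mul (v j) (v i) t, sub_eq_neg_add (v j * t), exp_add, neg_mul]
    ring

/-- After multiplication by exp (-v i * t), both inequalities compare functions vanishing at t = 0,
and their derivatives are compared by the case with one node fewer. -/
theorem expDividedDiff_nonneg_and_le {ι : Type*} [DecidableEq ι] (n : ℕ) :
    ∀ (s : Finset ι) (v : ι → ℝ) (B : ℝ), Set.InjOn v s → #s = n + 1 → (∀ i ∈ s, v i ≤ B) →
      ∀ t, 0 ≤ t → 0 ≤ expDividedDiff s v t ∧
        expDividedDiff s v t ≤ t ^ n / n.factorial * exp (B * t) := by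
  induction n with
  | zero =>
    intro s v B hv hs hB t ht
    obtain ⟨i, rfl⟩ := card_eq_one.1 hs
    have := hB i (by simp)
    simp only [expDividedDiff, nodalWeight, sum_singleton, erase_singleton, prod_empty, one_mul]
    refine ⟨(exp_pos _).le, ?_⟩
    simpa using mul_le_mul_of_nonneg_right this ht
  | succ n ih =>
    intro s v B hv hs hB t ht
    obtain ⟨i, hi⟩ : s.Nonempty := card_pos.1 (by omega)
    have ih' := ih (s.erase i) v B (hv.mono (by simp)) (by rw [card_erase_of_mem hi]; omega)
      (fun j hj => hB j (mem_erase.1 hj).2)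
    have hd := hasDerivAt_exp_mul_expDividedDiff hv hi
    have h0 := expDividedDiff_zero hv (by omega : 2 ≤ #s)
    have hfac : ((n + 1).factorial : ℝ) = (n + 1) * n.factorial := by
      rw [Nat.factorial_succ]; push_cast; ring
    have hn0 : (n.factorial : ℝ) ≠ 0 := by positivity
    constructor
    · have hm : MonotoneOn (fun t => exp (-v i * t) * expDividedDiff s v t) (Set.Ici 0) := by
        refine monotoneOn_of_deriv_nonneg (convex_Ici 0)
          (fun t _ => (hd t).continuousAt.continuousWithinAt)
          (fun t _ => (hd t).differentiableAt.differentiableWithinAt) fun t ht => ?_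
        rw [interior_Ici] at ht
        rw [(hd t).deriv]
        exact mul_nonneg (exp_pos _).le (ih' t (le_of_lt ht)).1
      have := hm (Set.self_mem_Ici) (Set.mem_Ici.2 ht) ht
      simp only [h0, mul_zero] at this
      exact (mul_nonneg_iff_of_pos_left (exp_pos _)).1 this
    · have hd2 : ∀ t, HasDerivAt (fun t : ℝ => t ^ (n + 1) / (n + 1).factorial * exp ((B - v i) * t)
          - exp (-v i * t) * expDividedDiff s v t)
          (t ^ n / n.factorial * exp ((B - v i) * t) +
            t ^ (n + 1) / (n + 1).factorial * (exp ((B - v i) * t) * (B - v i))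
            - exp (-v i * t) * expDividedDiff (s.erase i) v t) t := by
        intro t
        have e1 : HasDerivAt (fun t : ℝ => t ^ (n + 1) / (n + 1).factorial)
            (t ^ n / n.factorial) t := by
          have := (hasDerivAt_pow (n + 1) t).div_const ((n + 1).factorial : ℝ)
          refine this.congr_deriv ?_
          rw [hfac]
          push_cast
          field_simp
        have e2 : HasDerivAt (fun t : ℝ => exp ((B - v i) * t))
            (exp ((B - v i) * t) * (B - v i)) t := by
          simpa using (((hasDerivAt_id t).const_mul (B - v i)).exp)
        exact (e1.mul e2).sub (hd t)
      have hm : MonotoneOn (fun t : ℝ => t ^ (n + 1) / (n + 1).factorial * exp ((B - v i) * t)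
          - exp (-v i * t) * expDividedDiff s v t) (Set.Ici 0) := by
        refine monotoneOn_of_deriv_nonneg (convex_Ici 0)
          (fun t _ => (hd2 t).continuousAt.continuousWithinAt)
          (fun t _ => (hd2 t).differentiableAt.differentiableWithinAt) fun t ht => ?_
        rw [interior_Ici] at ht
        have ht' : 0 < t := ht
        rw [(hd2 t).deriv]
        have h1 := mul_le_mul_of_nonneg_left (ih' t ht'.le).2 (exp_pos (-v i * t)).le
        have h2 : exp (-v i * t) * (t ^ n / n.factorial * exp (B * t))
            = t ^ n / n.factorial * exp ((B - v i) * t) := by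
          rw [sub_mul, sub_eq_neg_add, exp_add, neg_mul]; ring
        have h3 : 0 ≤ t ^ (n + 1) / (n + 1).factorial * (exp ((B - v i) * t) * (B - v i)) := by
          have := sub_nonneg.2 (hB i hi)
          positivity
        linarith
      have := hm (Set.self_mem_Ici) (Set.mem_Ici.2 ht) ht
      simp only [h0, mul_zero, ne_eq, Nat.add_eq_zero_iff, one_ne_zero, and_false,
        not_false_eq_true, zero_pow, zero_div, zero_mul, sub_zero, sub_nonneg] at this
      have h2 : exp (-v i * t) * (t ^ (n + 1) / (n + 1).factorial * exp (B * t))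
            = t ^ (n + 1) / (n + 1).factorial * exp ((B - v i) * t) := by
          rw [sub_mul, sub_eq_neg_add, exp_add, neg_mul]; ring
      rw [← h2] at this
      exact le_of_mul_le_mul_left this (exp_pos _)

theorem expDividedDiff_neg {ι : Type*} [DecidableEq ι] {s : Finset ι} {v : ι → ℝ} {n : ℕ}
    (hs : #s = n + 1) (t : ℝ) :
    expDividedDiff s (-v) t = (-1) ^ n * expDividedDiff s v (-t) := by
  simp only [expDividedDiff, mul_sum]
  refine sum_congr rfl fun i hi => ?_
  have : nodalWeight s (-v) i = (-1) ^ n * nodalWeight s v i := by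
    have hc : n = #(s.erase i) := by rw [card_erase_of_mem hi]; omega
    rw [nodalWeight, nodalWeight, hc, ← prod_const, ← prod_mul_distrib]
    refine prod_congr rfl fun j _ => ?_
    rw [Pi.neg_apply, Pi.neg_apply, ← neg_sub_neg, neg_one_mul, ← inv_neg]
    congr 1
    ring
  rw [this, Pi.neg_apply, neg_mul, mul_neg]
  ring

theorem abs_expDividedDiff_le {ι : Type*} [DecidableEq ι] {s : Finset ι} {v : ι → ℝ} {n : ℕ}
    {B : ℝ} (hv : Set.InjOn v s) (hs : #s = n + 1) (h0 : ∀ i ∈ s, 0 ≤ v i)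
    (hB : ∀ i ∈ s, v i ≤ B) (t : ℝ) :
    |expDividedDiff s v t| ≤ |t| ^ n / n.factorial * exp (B * max t 0) := by
  rcases le_total 0 t with ht | ht
  · obtain ⟨h1, h2⟩ := expDividedDiff_nonneg_and_le n s v B hv hs hB t ht
    rwa [abs_of_nonneg h1, abs_of_nonneg ht, max_eq_left ht]
  -- Negative t is reduced to positive t by reflecting the nodes; these are then at most 0, so no
  -- exponential factor appears.
  · have hv' : Set.InjOn (-v) s := fun i hi j hj h => hv hi hj (neg_injective h)
    obtain ⟨h1, h2⟩ := expDividedDiff_nonneg_and_le n s (-v) 0 hv' hs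
      (fun i hi => by simpa using h0 i hi) (-t) (by linarith)
    have h3 := expDividedDiff_neg (v := v) hs (-t)
    rw [neg_neg] at h3
    rw [max_eq_right ht, abs_of_nonpos ht]
    have : |expDividedDiff s v t| = expDividedDiff s (-v) (-t) := by
      rw [← abs_of_nonneg h1, h3, abs_mul, abs_pow, abs_neg, abs_one, one_pow, one_mul]
    rw [this]
    simpa using h2

/-! ### Padé coefficients: integrality, link with nodal weights, size -/

/-- Integer coefficients of the diagonal Padé approximants to `w = W ^ (1 / r)` at `W = 1`;
the numerator has `ε = 1`, the denominator `ε = -1`. -/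
def padeCoeff (r : ℕ) (ε : ℤ) (n k : ℕ) : ℤ :=
  (-1) ^ (n - k) * ((r ^ k * ∏ j ∈ range k, (-(r * n) - ε + r * j)) / k.factorial) *
    ((r ^ (n - k) * ∏ j ∈ range (n - k), (r * (k + 1) - ε + r * j)) / (n - k).factorial)

theorem padeCoeff_mul_factorial (r : ℕ) (ε : ℤ) (k m : ℕ) :
    padeCoeff r ε (k + m) k * (k.factorial * m.factorial) =
      (-1) ^ m * r ^ (k + m) * (∏ j ∈ range k, (-(r * (k + m)) - ε + r * j : ℤ)) *
        ∏ j ∈ range m, (r * (k + 1) - ε + r * j : ℤ) := by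
  obtain ⟨q₁, h1⟩ := factorial_dvd_pow_mul_prod_arith r k (-(r * (k + m)) - ε)
  obtain ⟨q₂, h2⟩ := factorial_dvd_pow_mul_prod_arith r m (r * (k + 1) - ε)
  rw [padeCoeff, Nat.add_sub_cancel_left]
  push_cast
  rw [h1, h2, Int.mul_ediv_cancel_left _ (by positivity), Int.mul_ediv_cancel_left _ (by positivity)]
  calc _ = (-1 : ℤ) ^ m * (k.factorial * q₁) * (m.factorial * q₂) := by ring
    _ = _ := by rw [← h1, ← h2]; ring

theorem prod_range_erase_eq {M : Type*} [CommMonoid M] (f : ℕ → M) (k m : ℕ) :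
    ∏ j ∈ (range (k + m + 1)).erase k, f j
      = (∏ j ∈ range k, f j) * ∏ j ∈ range m, f (k + 1 + j) := by
  have h : ∏ j ∈ (range (k + m + 1)).erase k, f j
      = ∏ j ∈ range (k + 1 + m), Function.update f k 1 j := by
    rw [show k + m + 1 = k + 1 + m by ring, ← prod_erase _ (Function.update_self k 1 f)]
    refine prod_congr rfl fun j hj => ?_
    rw [Function.update_of_ne (mem_erase.1 hj).1]
  rw [h, prod_range_add, prod_range_succ, Function.update_self, mul_one]
  congr 1
  · refine prod_congr rfl fun j hj => ?_
    rw [Function.update_of_ne (mem_range.1 hj).ne]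
  · refine prod_congr rfl fun j _ => ?_
    rw [Function.update_of_ne (by omega)]

theorem prod_range_erase_sub (k m : ℕ) :
    ∏ j ∈ (range (k + m + 1)).erase k, ((k : ℝ) - j) = (-1) ^ m * (k.factorial * m.factorial) := by
  rw [prod_range_erase_eq]
  have h1 : ∏ j ∈ range k, ((k : ℝ) - j) = k.factorial := by
    rw [← prod_range_reflect, ← prod_range_add_one_eq_factorial]
    push_cast
    refine prod_congr rfl fun j hj => ?_
    have := mem_range.1 hj
    rw [Nat.cast_sub (by omega), Nat.cast_sub (by omega)]
    push_cast
    ring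
  have h2 : ∏ j ∈ range m, ((k : ℝ) - (k + 1 + j : ℕ)) = (-1) ^ m * m.factorial := by
    rw [← prod_range_add_one_eq_factorial]
    push_cast
    nth_rewrite 2 [← card_range m]
    rw [← prod_const, ← prod_mul_distrib]
    refine prod_congr rfl fun j _ => ?_
    ring
  rw [h1, h2]
  ring

/-- The product of `r m - ε` over `|m| ≤ n`. -/
noncomputable def centralProd (r : ℕ) (ε : ℝ) (n : ℕ) : ℝ :=
  ∏ i ∈ range (2 * n + 1), (r * ((i : ℝ) - n) - ε)

theorem centralProd_succ (r : ℕ) (ε : ℝ) (n : ℕ) :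
    centralProd r ε (n + 1) = centralProd r ε n * (ε ^ 2 - (r * (n + 1)) ^ 2) := by
  rw [centralProd, show 2 * (n + 1) + 1 = 2 * n + 1 + 1 + 1 by ring, prod_range_succ,
    prod_range_succ', centralProd]
  push_cast
  have : ∀ i : ℕ, (r * ((i : ℝ) + 1 - (n + 1)) - ε) = r * ((i : ℝ) - n) - ε := fun i => by ring
  simp only [this]
  ring

theorem centralProd_neg (r : ℕ) (ε : ℝ) (n : ℕ) :
    centralProd r (-ε) n = - centralProd r ε n := by
  induction n with
  | zero => simp [centralProd]
  | succ n ih => rw [centralProd_succ, centralProd_succ, ih]; ring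

theorem abs_centralProd_le {r : ℕ} (hr : 1 ≤ r) (n : ℕ) :
    |centralProd r 1 n| ≤ (r : ℝ) ^ (2 * n) * (n.factorial : ℝ) ^ 2 := by
  induction n with
  | zero => simp [centralProd]
  | succ n ih =>
    rw [centralProd_succ, abs_mul]
    have hr' : (1 : ℝ) ≤ r := by exact_mod_cast hr
    have h1 : |(1 : ℝ) ^ 2 - ((r : ℝ) * (n + 1)) ^ 2| ≤ ((r : ℝ) * (n + 1)) ^ 2 := by
      have : (1 : ℝ) ≤ ((r : ℝ) * (n + 1)) ^ 2 := by
        apply one_le_pow₀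
        nlinarith [(Nat.cast_nonneg n : (0 : ℝ) ≤ n)]
      rw [abs_le]
      constructor <;> linarith
    calc _ ≤ (r : ℝ) ^ (2 * n) * (n.factorial : ℝ) ^ 2 * ((r : ℝ) * (n + 1)) ^ 2 :=
          mul_le_mul ih h1 (abs_nonneg _) (by positivity)
      _ = _ := by rw [Nat.factorial_succ]; push_cast; ring

/-- For j = 0, …, n the numbers r(k - j) - ε form the middle block of the factors of the central
product; the two outer blocks are the products in `padeCoeff`. The left side does not depend on k,
so it is a common denominator for all nodal weights. -/
theorem pow_mul_centralProd_eq (r : ℕ) (ε : ℤ) {n k : ℕ} (hk : k ≤ n) :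
    (r : ℝ) ^ (2 * n) * centralProd r ε n = padeCoeff r ε n k *
      ((∏ j ∈ (range (n + 1)).erase k, ((r : ℝ) * k - r * j)) *
        ∏ j ∈ range (n + 1), ((r : ℝ) * k - r * j - ε)) := by
  obtain ⟨m, rfl⟩ := Nat.exists_eq_add_of_le hk
  have h1 : ∏ j ∈ (range (k + m + 1)).erase k, ((r : ℝ) * k - r * j)
      = r ^ (k + m) * ((-1) ^ m * (k.factorial * m.factorial)) := by
    have : #((range (k + m + 1)).erase k) = k + m := by
      rw [card_erase_of_mem (by simp), card_range]; rfl
    have hc : (r : ℝ) ^ (k + m) = ∏ j ∈ (range (k + m + 1)).erase k, (r : ℝ) := by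
      rw [prod_const, this]
    rw [← prod_range_erase_sub, hc, ← prod_mul_distrib]
    exact prod_congr rfl fun j _ => by ring
  have h2 : centralProd r ε (k + m) = (∏ j ∈ range k, (-(r * (k + m)) - ε + r * j : ℝ)) *
      (∏ j ∈ range (k + m + 1), ((r : ℝ) * k - r * j - ε)) *
        ∏ j ∈ range m, (r * (k + 1) - ε + r * j : ℝ) := by
    rw [centralProd, show 2 * (k + m) + 1 = k + (k + m + 1) + m by ring, prod_range_add,
      prod_range_add]
    congr 1
    · congr 1
      · exact prod_congr rfl fun j _ => by push_cast; ring
      · rw [← prod_range_reflect]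
        refine prod_congr rfl fun j hj => ?_
        have := mem_range.1 hj
        rw [show k + m + 1 - 1 - j = k + m - j by omega]
        push_cast
        rw [Nat.cast_sub (by omega)]
        push_cast
        ring
    · exact prod_congr rfl fun j _ => by push_cast; ring
  have h3 := congrArg (Int.cast : ℤ → ℝ) (padeCoeff_mul_factorial r ε k m)
  push_cast at h3
  rw [h1, h2]
  have h4 : ((-1 : ℝ) ^ m) * (-1) ^ m = 1 := by rw [← mul_pow]; simp
  linear_combination (-(-1 : ℝ) ^ m * r ^ (k + m) *
    ∏ j ∈ range (k + m + 1), ((r : ℝ) * k - r * j - ε)) * h3 -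
    (r : ℝ) ^ (2 * (k + m)) * (∏ j ∈ range k, (-(r * (k + m)) - ε + r * j : ℝ)) *
      (∏ j ∈ range (k + m + 1), ((r : ℝ) * k - r * j - ε)) *
        (∏ j ∈ range m, (r * (k + 1) - ε + r * j : ℝ)) * h4

/-- Each factor r i - ε with i ≠ 0 is at most 2r|i| in absolute value, and the remaining products of
the |i| are k! and (n - k)! times binomial coefficients. -/
theorem abs_padeCoeff_le {r : ℕ} (hr : 1 ≤ r) {ε : ℤ} (hε : |ε| ≤ 1) {n k : ℕ} (hk : k ≤ n) :
    |padeCoeff r ε n k| ≤ (2 * r ^ 2) ^ n * (n.choose k : ℤ) ^ 2 := by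
  obtain ⟨m, rfl⟩ := Nat.exists_eq_add_of_le hk
  have hr' : (1 : ℤ) ≤ r := by exact_mod_cast hr
  obtain ⟨hε1, hε2⟩ := abs_le.1 hε
  have h1 : |∏ j ∈ range k, (-(r * (k + m)) - ε + r * j : ℤ)| ≤
      (2 * r) ^ k * (k.factorial * (k + m).choose k) := by
    have e : ((2 * r : ℤ)) ^ k * (k.factorial * (k + m).choose k)
        = ∏ j ∈ range k, (2 * r) * ((k + m - j : ℕ) : ℤ) := by
      rw [prod_mul_distrib, prod_const, card_range]
      congr 1
      rw [← Nat.cast_prod, ← Nat.descFactorial_eq_prod_range,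
        Nat.descFactorial_eq_factorial_mul_choose]
      push_cast
      rfl
    rw [e, abs_prod]
    refine prod_le_prod (fun _ _ => abs_nonneg _) fun j hj => ?_
    have hj' := mem_range.1 hj
    obtain ⟨i, rfl⟩ : ∃ i, k = j + 1 + i := Nat.exists_eq_add_of_le hj'
    rw [show j + 1 + i + m - j = 1 + i + m by omega, abs_le]
    push_cast
    constructor <;> nlinarith [mul_nonneg (by positivity : (0 : ℤ) ≤ r) (by positivity : (0 : ℤ) ≤ i + m)]
  have h2 : |∏ j ∈ range m, (r * (k + 1) - ε + r * j : ℤ)| ≤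
      (2 * r) ^ m * (m.factorial * (k + m).choose k) := by
    have e : ((2 * r : ℤ)) ^ m * (m.factorial * (k + m).choose k)
        = ∏ j ∈ range m, (2 * r) * ((k + 1 + j : ℕ) : ℤ) := by
      rw [prod_mul_distrib, prod_const, card_range]
      congr 1
      rw [← Nat.cast_prod, ← Nat.ascFactorial_eq_prod_range,
        Nat.ascFactorial_eq_factorial_mul_choose, Nat.choose_symm_add]
      push_cast
      rfl
    rw [e, abs_prod]
    refine prod_le_prod (fun _ _ => abs_nonneg _) fun j hj => ?_
    rw [abs_le]
    push_cast
    constructor <;> nlinarith [mul_nonneg (by positivity : (0 : ℤ) ≤ r) (by positivity : (0 : ℤ) ≤ k + j)]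
  have h3 := congrArg abs (padeCoeff_mul_factorial r ε k m)
  simp only [abs_mul, abs_pow, abs_neg, abs_one, one_pow, one_mul, Nat.abs_cast] at h3
  refine le_of_mul_le_mul_right ?_ (by positivity : (0 : ℤ) < k.factorial * m.factorial)
  rw [h3, mul_assoc]
  calc _ ≤ (r : ℤ) ^ (k + m) * (((2 * r) ^ k * (k.factorial * (k + m).choose k)) *
        ((2 * r) ^ m * (m.factorial * (k + m).choose k))) := by gcongr
    _ = _ := by ring

theorem sum_abs_padeCoeff_le {r : ℕ} (hr : 1 ≤ r) {ε : ℤ} (hε : |ε| ≤ 1) (n : ℕ) :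
    ∑ k ∈ range (n + 1), |padeCoeff r ε n k| ≤ (8 * r ^ 2) ^ n := by
  have h1 : ∑ k ∈ range (n + 1), ((n.choose k : ℤ)) ^ 2 ≤ 4 ^ n := by
    have h2 : ∑ k ∈ range (n + 1), (n.choose k : ℤ) = 2 ^ n := by
      exact_mod_cast Nat.sum_range_choose n
    rw [show (4 : ℤ) ^ n = (2 ^ n) ^ 2 by rw [← pow_mul, mul_comm, pow_mul]; norm_num, ← h2]
    exact sum_sq_le_sq_sum_of_nonneg fun _ _ => by positivity
  calc _ ≤ ∑ k ∈ range (n + 1), (2 * r ^ 2 : ℤ) ^ n * (n.choose k : ℤ) ^ 2 :=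
        sum_le_sum fun k hk => abs_padeCoeff_le hr hε (by have := mem_range.1 hk; omega)
    _ ≤ (2 * r ^ 2) ^ n * 4 ^ n := by
        rw [← mul_sum]; exact mul_le_mul_of_nonneg_left h1 (by positivity)
    _ = _ := by rw [← mul_pow]; ring

/-! ### Padé polynomials and their remainder -/

open Polynomial in
/-- The polynomial with coefficients `padeCoeff r ε n`. -/
noncomputable def padePoly (r : ℕ) (ε : ℤ) (n : ℕ) : ℝ[X] :=
  ∑ k ∈ range (n + 1), C (padeCoeff r ε n k : ℝ) * X ^ k

theorem eval_padePoly (r : ℕ) (ε : ℤ) (n : ℕ) (W : ℝ) :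
    (padePoly r ε n).eval W = ∑ k ∈ range (n + 1), (padeCoeff r ε n k : ℝ) * W ^ k := by
  simp [padePoly, Polynomial.eval_finsetSum]

theorem natDegree_padePoly_le (r : ℕ) (ε : ℤ) (n : ℕ) : (padePoly r ε n).natDegree ≤ n :=
  Polynomial.natDegree_sum_le_of_forall_le _ _ fun k hk =>
    (Polynomial.natDegree_C_mul_X_pow_le _ _).trans (by have := mem_range.1 hk; omega)

/-- The exponents `r k` and `r k + 1` for `k ≤ n`. -/
def padeNode (r : ℕ) : ℕ ⊕ ℕ → ℝ := Sum.elim (fun k => r * k) fun k => r * k + 1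

theorem padeNode_injective {r : ℕ} (hr : 2 ≤ r) : Function.Injective (padeNode r) := by
  have key : ∀ i j : ℕ, (r : ℝ) * i ≠ r * j + 1 := by
    intro i j h
    have h' : r * i = r * j + 1 := by exact_mod_cast h
    have : r ∣ 1 := (Nat.dvd_add_right (dvd_mul_right r j)).1 (h' ▸ dvd_mul_right r i)
    have := Nat.le_of_dvd one_pos this
    omega
  have hr0 : (r : ℝ) ≠ 0 := by positivity
  rintro (i | i) (j | j) h <;> simp only [padeNode, Sum.elim_inl, Sum.elim_inr] at h
  · rw [mul_right_inj' hr0, Nat.cast_inj] at h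
    rw [h]
  · exact absurd h (key i j)
  · exact absurd h.symm (key j i)
  · rw [add_left_inj, mul_right_inj' hr0, Nat.cast_inj] at h
    rw [h]

theorem nodalWeight_padeNode_inl (r n k : ℕ) (hr : 2 ≤ r) (hk : k ≤ n) :
    (r : ℝ) ^ (2 * n) * centralProd r 1 n *
      nodalWeight ((range (n + 1)).disjSum (range (n + 1))) (padeNode r) (Sum.inl k)
        = padeCoeff r 1 n k := by
  have h := pow_mul_centralProd_eq r 1 hk
  have hw : nodalWeight ((range (n + 1)).disjSum (range (n + 1))) (padeNode r) (Sum.inl k)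
      = ((∏ j ∈ (range (n + 1)).erase k, ((r : ℝ) * k - r * j)) *
        ∏ j ∈ range (n + 1), ((r : ℝ) * k - r * j - (1 : ℤ)))⁻¹ := by
    have e : ((range (n + 1)).disjSum (range (n + 1))).erase (Sum.inl k)
        = ((range (n + 1)).erase k).disjSum (range (n + 1)) := by
      ext (j | j) <;> simp
    rw [nodalWeight, e, prod_disjSum, mul_inv, ← prod_inv_distrib, ← prod_inv_distrib]
    congr 1
    refine prod_congr rfl fun j _ => ?_
    simp only [padeNode, Sum.elim_inl, Sum.elim_inr]
    push_cast
    ring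
  have hne := nodalWeight_ne_zero (s := (range (n + 1)).disjSum (range (n + 1)))
    (padeNode_injective hr).injOn (i := Sum.inl k) (by simp; omega)
  rw [hw] at hne ⊢
  push_cast at h hne ⊢
  rw [h, mul_assoc, mul_inv_cancel₀ (mt inv_eq_zero.2 hne), mul_one]

theorem nodalWeight_padeNode_inr (r n k : ℕ) (hr : 2 ≤ r) (hk : k ≤ n) :
    (r : ℝ) ^ (2 * n) * centralProd r 1 n *
      nodalWeight ((range (n + 1)).disjSum (range (n + 1))) (padeNode r) (Sum.inr k)
        = -padeCoeff r (-1) n k := by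
  have h := pow_mul_centralProd_eq r (-1) hk
  have hw : nodalWeight ((range (n + 1)).disjSum (range (n + 1))) (padeNode r) (Sum.inr k)
      = ((∏ j ∈ (range (n + 1)).erase k, ((r : ℝ) * k - r * j)) *
        ∏ j ∈ range (n + 1), ((r : ℝ) * k - r * j - (-1 : ℤ)))⁻¹ := by
    have e : ((range (n + 1)).disjSum (range (n + 1))).erase (Sum.inr k)
        = (range (n + 1)).disjSum ((range (n + 1)).erase k) := by
      ext (j | j) <;> simp
    rw [nodalWeight, e, prod_disjSum, mul_inv, ← prod_inv_distrib, ← prod_inv_distrib, mul_comm]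
    congr 1
    · refine prod_congr rfl fun j _ => ?_
      simp only [padeNode, Sum.elim_inr]
      ring
    · refine prod_congr rfl fun j _ => ?_
      simp only [padeNode, Sum.elim_inl, Sum.elim_inr]
      push_cast
      ring
  have hne := nodalWeight_ne_zero (s := (range (n + 1)).disjSum (range (n + 1)))
    (padeNode_injective hr).injOn (i := Sum.inr k) (by simp; omega)
  rw [hw] at hne ⊢
  push_cast at h hne ⊢
  rw [centralProd_neg, mul_neg, neg_eq_iff_eq_neg] at h
  rw [h, neg_mul, mul_assoc, mul_inv_cancel₀ (mt inv_eq_zero.2 hne), mul_one]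

theorem padePoly_remainder_eq {r : ℕ} (hr : 2 ≤ r) (n : ℕ) (t : ℝ) :
    (padePoly r 1 n).eval (exp (r * t)) - exp t * (padePoly r (-1) n).eval (exp (r * t)) =
      (r : ℝ) ^ (2 * n) * centralProd r 1 n *
        expDividedDiff ((range (n + 1)).disjSum (range (n + 1))) (padeNode r) t := by
  rw [expDividedDiff, sum_disjSum, mul_add, mul_sum, mul_sum, eval_padePoly, eval_padePoly,
    sub_eq_add_neg, ← mul_neg, ← sum_neg_distrib, mul_sum]
  congr 1
  · refine sum_congr rfl fun k hk => ?_
    rw [← mul_assoc, nodalWeight_padeNode_inl r n k hr (by have := mem_range.1 hk; omega),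
      ← exp_nat_mul]
    simp only [padeNode, Sum.elim_inl]
    congr 2
    ring
  · refine sum_congr rfl fun k hk => ?_
    rw [← mul_assoc, nodalWeight_padeNode_inr r n k hr (by have := mem_range.1 hk; omega),
      ← exp_nat_mul]
    simp only [padeNode, Sum.elim_inr]
    rw [show ((r : ℝ) * k + 1) * t = t + k * (r * t) by ring, exp_add]
    ring

/-- The factor n!^2 from the central product is absorbed by the (2n + 1)! of the divided difference.
-/
theorem abs_padePoly_remainder_le {r : ℕ} (hr : 2 ≤ r) (n : ℕ) (t : ℝ) :
    |(padePoly r 1 n).eval (exp (r * t)) - exp t * (padePoly r (-1) n).eval (exp (r * t))| ≤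
      (r : ℝ) ^ (4 * n) * |t| ^ (2 * n + 1) * exp ((r * n + 1) * max t 0) := by
  rw [padePoly_remainder_eq hr, abs_mul, abs_mul, abs_of_nonneg (by positivity : (0 : ℝ) ≤ r ^ (2 * n))]
  have h1 := abs_expDividedDiff_le (s := (range (n + 1)).disjSum (range (n + 1)))
    (n := 2 * n + 1) (B := r * n + 1) (padeNode_injective hr).injOn
    (by rw [card_disjSum, card_range]; ring)
    (by rintro (i | i) hi <;> simp only [padeNode, Sum.elim_inl, Sum.elim_inr] <;> positivity)
    (by
      rintro (i | i) hi
      all_goals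
        have hi' : i ≤ n := by simp at hi; omega
        have : (r : ℝ) * i ≤ r * n := by gcongr
        simp only [padeNode, Sum.elim_inl, Sum.elim_inr]
        linarith) t
  have h2 : (n.factorial : ℝ) ^ 2 ≤ (2 * n + 1).factorial := by
    have : n.factorial * n.factorial ≤ (2 * n + 1).factorial :=
      (Nat.le_of_dvd (Nat.factorial_pos _) (Nat.factorial_mul_factorial_dvd_factorial_add n n)).trans
        (Nat.factorial_le (by omega))
    rw [sq]
    exact_mod_cast this
  have h0 : (0 : ℝ) < (2 * n + 1).factorial := by positivity
  calc _ ≤ (r : ℝ) ^ (2 * n) * ((r : ℝ) ^ (2 * n) * (n.factorial : ℝ) ^ 2) *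
        (|t| ^ (2 * n + 1) / (2 * n + 1).factorial * exp ((r * n + 1) * max t 0)) := by
        gcongr
        exact abs_centralProd_le (by omega) n
    _ = (r : ℝ) ^ (4 * n) * |t| ^ (2 * n + 1) * exp ((r * n + 1) * max t 0) *
        ((n.factorial : ℝ) ^ 2 / (2 * n + 1).factorial) := by
        rw [show 4 * n = 2 * n + 2 * n by ring, pow_add]; ring
    _ ≤ _ := mul_le_of_le_one_right (by positivity) ((div_le_one h0).2 h2)

/-! ### Nonvanishing of the cross determinant -/

open Polynomial in
-- If 1 were a root of multiplicity below m, the cofactor would still tend to 0 as W decreases to 1,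
-- so it would vanish at 1.
theorem X_sub_C_pow_dvd_of_abs_eval_le {h : ℝ[X]} {M : ℝ} {m : ℕ}
    (hM : ∀ W, 1 < W → W ≤ 2 → |h.eval W| ≤ M * (W - 1) ^ m) : (X - C 1) ^ m ∣ h := by
  rcases eq_or_ne h 0 with rfl | h0
  · exact dvd_zero _
  obtain ⟨g, hg, hdvd⟩ := exists_eq_pow_rootMultiplicity_mul_and_not_dvd h h0 1
  by_cases hk : m ≤ rootMultiplicity 1 h
  · exact (pow_dvd_pow _ hk).trans (pow_rootMultiplicity_dvd h 1)
  exfalso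
  apply hdvd
  rw [dvd_iff_isRoot, IsRoot.def, ← abs_nonpos_iff]
  set k := rootMultiplicity 1 h
  have hb : ∀ W, 1 < W → W ≤ 2 → |g.eval W| ≤ M * (W - 1) ^ (m - k) := by
    intro W h1 h2
    have := hM W h1 h2
    have hpos : 0 < (W - 1) ^ k := pow_pos (by linarith) k
    rw [hg, eval_mul, eval_pow, eval_sub, eval_X, eval_C, abs_mul, abs_of_pos hpos] at this
    refine le_of_mul_le_mul_left (this.trans_eq ?_) hpos
    rw [mul_left_comm, ← pow_add]
    congr 2
    omega
  have t1 : Filter.Tendsto (fun W : ℝ => |g.eval W|) (nhdsWithin 1 (Set.Ioi 1))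
      (nhds |g.eval 1|) :=
    (g.continuous.abs.tendsto 1).mono_left nhdsWithin_le_nhds
  have t2 : Filter.Tendsto (fun W : ℝ => M * (W - 1) ^ (m - k)) (nhdsWithin 1 (Set.Ioi 1))
      (nhds 0) := by
    have : Continuous fun W : ℝ => M * (W - 1) ^ (m - k) := by fun_prop
    have := (this.tendsto 1).mono_left (nhdsWithin_le_nhds (s := Set.Ioi 1))
    rwa [sub_self, zero_pow (by omega), mul_zero] at this
  refine le_of_tendsto_of_tendsto t1 t2 ?_
  filter_upwards [Ioc_mem_nhdsGT (by norm_num : (1 : ℝ) < 2)] with W hW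
  exact hb W hW.1 hW.2

/-- The cross determinant of two consecutive Padé approximants. -/
noncomputable def padeCross (r n : ℕ) : Polynomial ℝ :=
  padePoly r 1 n * padePoly r (-1) (n + 1) - padePoly r 1 (n + 1) * padePoly r (-1) n

theorem X_sub_C_pow_dvd_padeCross {r : ℕ} (hr : 2 ≤ r) (n : ℕ) :
    (Polynomial.X - Polynomial.C 1) ^ (2 * n + 1) ∣ padeCross r n := by
  obtain ⟨M₁, hM₁⟩ := (isCompact_Icc (a := (1 : ℝ)) (b := 2)).exists_bound_of_continuousOn
    (padePoly r (-1) (n + 1)).continuous.continuousOn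
  obtain ⟨M₂, hM₂⟩ := (isCompact_Icc (a := (1 : ℝ)) (b := 2)).exists_bound_of_continuousOn
    (padePoly r (-1) n).continuous.continuousOn
  set K : ℕ → ℝ := fun n => (r : ℝ) ^ (4 * n) * exp (r * n + 1)
  refine X_sub_C_pow_dvd_of_abs_eval_le (M := K n * M₁ + K (n + 1) * M₂) fun W h1 h2 => ?_
  have hb₁ := hM₁ W ⟨h1.le, h2⟩
  have hb₂ := hM₂ W ⟨h1.le, h2⟩
  rw [norm_eq_abs] at hb₁ hb₂
  have hW0 : 0 < W := by linarith
  have hr1 : (1 : ℝ) ≤ r := by exact_mod_cast (by omega : 1 ≤ r)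
  have hlog0 : 0 ≤ log W := log_nonneg h1.le
  have hlog : log W ≤ W - 1 := log_le_sub_one_of_pos hW0
  set t := log W / r with ht
  have ht0 : 0 ≤ t := by positivity
  have htW : t ≤ W - 1 := (div_le_self hlog0 hr1).trans hlog
  have hexp : exp (r * t) = W := by
    rw [ht, mul_div_cancel₀ _ (by positivity), exp_log hW0]
  have hR : ∀ m, n ≤ m →
      |(padePoly r 1 m).eval W - exp t * (padePoly r (-1) m).eval W| ≤
        K m * (W - 1) ^ (2 * n + 1) := by
    intro m hm
    have := abs_padePoly_remainder_le hr m t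
    rw [hexp, abs_of_nonneg ht0, max_eq_left ht0] at this
    refine this.trans ?_
    have e1 : t ^ (2 * m + 1) ≤ (W - 1) ^ (2 * n + 1) :=
      (pow_le_pow_left₀ ht0 htW _).trans
        (pow_le_pow_of_le_one (by linarith) (by linarith) (by omega))
    have e2 : exp ((r * m + 1) * t) ≤ exp (r * m + 1) := by
      apply exp_le_exp.2
      exact mul_le_of_le_one_right (by positivity) (by linarith)
    calc _ ≤ (r : ℝ) ^ (4 * m) * (W - 1) ^ (2 * n + 1) * exp (r * m + 1) := by gcongr
      _ = _ := by simp only [K]; ring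
  -- The terms with W^(1/r) = exp t cancel, so the determinant is a combination of two remainders,
  -- each O((W - 1)^(2n+1)).
  have key : (padeCross r n).eval W =
      ((padePoly r 1 n).eval W - exp t * (padePoly r (-1) n).eval W) *
        (padePoly r (-1) (n + 1)).eval W -
      ((padePoly r 1 (n + 1)).eval W - exp t * (padePoly r (-1) (n + 1)).eval W) *
        (padePoly r (-1) n).eval W := by
    simp only [padeCross, Polynomial.eval_sub, Polynomial.eval_mul]
    ring
  rw [key]
  have hW1 : 0 ≤ (W - 1) ^ (2 * n + 1) := pow_nonneg (by linarith) _
  have hK : ∀ m, 0 ≤ K m := fun m => by positivity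
  calc _ ≤ _ := abs_sub _ _
    _ ≤ K n * (W - 1) ^ (2 * n + 1) * M₁ + K (n + 1) * (W - 1) ^ (2 * n + 1) * M₂ := by
      rw [abs_mul, abs_mul]
      exact add_le_add
        (mul_le_mul (hR n le_rfl) hb₁ (abs_nonneg _) (mul_nonneg (hK _) hW1))
        (mul_le_mul (hR _ (by omega)) hb₂ (abs_nonneg _) (mul_nonneg (hK _) hW1))
    _ = _ := by ring

/-- From n to n + 1 the constant terms acquire the factors r(n + 1) - 1 and r(n + 1) + 1
respectively, besides common ones; their difference 2 survives in the determinant. -/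
theorem eval_zero_padeCross_ne_zero {r : ℕ} (hr : 2 ≤ r) (n : ℕ) :
    (padeCross r n).eval 0 ≠ 0 := by
  have h0 : ∀ ε m, (padePoly r ε m).eval 0 = padeCoeff r ε m 0 := by
    intro ε m
    rw [eval_padePoly, sum_range_succ']
    simp
  have hc : ∀ (ε : ℤ) m, padeCoeff r ε m 0 * m.factorial
      = (-1) ^ m * r ^ m * ∏ j ∈ range m, (r * (j + 1) - ε : ℤ) := by
    intro ε m
    have := padeCoeff_mul_factorial r ε 0 m
    simp only [zero_add, Nat.factorial_zero, Nat.cast_one, one_mul, range_zero, prod_empty,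
      mul_one] at this
    rw [this]
    congr 1
    exact prod_congr rfl fun j _ => by push_cast; ring
  have hT : ∀ ε : ℤ, ε ≤ 1 → ∏ j ∈ range n, (r * (j + 1) - ε : ℤ) ≠ 0 := by
    intro ε hε
    refine prod_ne_zero_iff.2 fun j _ => ne_of_gt ?_
    have : (2 : ℤ) ≤ r := by exact_mod_cast hr
    nlinarith [(Nat.cast_nonneg j : (0 : ℤ) ≤ j)]
  have e1 := hc 1 n
  have e2 := hc (-1) n
  have e3 := hc 1 (n + 1)
  have e4 := hc (-1) (n + 1)
  rw [prod_range_succ] at e3 e4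
  intro h
  simp only [padeCross, Polynomial.eval_sub, Polynomial.eval_mul, h0] at h
  have h' : padeCoeff r 1 n 0 * padeCoeff r (-1) (n + 1) 0 -
      padeCoeff r 1 (n + 1) 0 * padeCoeff r (-1) n 0 = 0 := by exact_mod_cast h
  have : (padeCoeff r 1 n 0 * padeCoeff r (-1) (n + 1) 0 -
      padeCoeff r 1 (n + 1) 0 * padeCoeff r (-1) n 0) * (n.factorial * (n + 1).factorial) =
      -2 * (((-1) ^ n) ^ 2 * r ^ (2 * n + 1) * (∏ j ∈ range n, (r * (j + 1) - 1 : ℤ)) *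
        ∏ j ∈ range n, (r * (j + 1) - (-1) : ℤ)) := by
    calc _ = (padeCoeff r 1 n 0 * n.factorial) * (padeCoeff r (-1) (n + 1) 0 * (n + 1).factorial) -
          (padeCoeff r 1 (n + 1) 0 * (n + 1).factorial) * (padeCoeff r (-1) n 0 * n.factorial) := by
          ring
      _ = _ := by rw [e1, e2, e3, e4]; ring
  rw [h', zero_mul] at this
  have hr0 : (r : ℤ) ≠ 0 := by positivity
  have := hT 1 le_rfl
  have := hT (-1) (by norm_num)
  simp_all

/-- The degree is at most 2n + 1, so the determinant is a constant times (W - 1)^(2n+1), and its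
value at 0 shows the constant is nonzero. -/
theorem eval_padeCross_ne_zero {r : ℕ} (hr : 2 ≤ r) (n : ℕ) {W : ℝ} (hW : W ≠ 1) :
    (padeCross r n).eval W ≠ 0 := by
  obtain ⟨q, hq⟩ := X_sub_C_pow_dvd_padeCross hr n
  have h0 := eval_zero_padeCross_ne_zero hr n
  have hq0 : q ≠ 0 := by
    rintro rfl
    simp [hq] at h0
  have hX : (Polynomial.X - Polynomial.C (1 : ℝ)) ^ (2 * n + 1) ≠ 0 :=
    pow_ne_zero _ (Polynomial.X_sub_C_ne_zero 1)
  have hdeg : (padeCross r n).natDegree ≤ 2 * n + 1 := by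
    have d := natDegree_padePoly_le r
    refine (Polynomial.natDegree_sub_le _ _).trans (max_le ?_ ?_)
    · refine Polynomial.natDegree_mul_le.trans ?_
      have := d 1 n; have := d (-1) (n + 1); omega
    · refine Polynomial.natDegree_mul_le.trans ?_
      have := d (-1) n; have := d 1 (n + 1); omega
  rw [hq, Polynomial.natDegree_mul hX hq0, Polynomial.natDegree_pow, Polynomial.natDegree_X_sub_C]
    at hdeg
  obtain ⟨a, rfl⟩ := Polynomial.natDegree_eq_zero.1 (by omega : q.natDegree = 0)
  rw [hq]
  simp only [Polynomial.eval_mul, Polynomial.eval_pow, Polynomial.eval_sub, Polynomial.eval_X,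
    Polynomial.eval_C]
  exact mul_ne_zero (pow_ne_zero _ (sub_ne_zero.2 hW)) fun h => hq0 (by rw [h, Polynomial.C_0])

/-! ### Estimates for the homogeneous forms -/

theorem mul_pow_mul_abs_sub_le {r : ℕ} (hr : 1 ≤ r) {u v : ℝ} (hu : 0 < u) (hv : 0 < v) :
    r * (min u v) ^ (r - 1) * |u - v| ≤ |u ^ r - v ^ r| := by
  wlog h : v ≤ u generalizing u v
  · rw [min_comm, abs_sub_comm, abs_sub_comm (u ^ r)]
    exact this hv hu (le_of_not_ge h)
  rw [min_eq_right h, abs_of_nonneg (sub_nonneg.2 h),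
    abs_of_nonneg (sub_nonneg.2 (pow_le_pow_left₀ hv.le h r))]
  obtain ⟨m, rfl⟩ := Nat.exists_eq_add_of_le' hr
  have h1 := one_add_mul_le_pow (a := u / v - 1) (by have : 0 < u / v := by positivity
                                                     linarith) (m + 1)
  rw [add_sub_cancel, div_pow, le_div_iff₀ (by positivity)] at h1
  have h2 : (1 + ((m + 1 : ℕ) : ℝ) * (u / v - 1)) * v ^ (m + 1)
      = v ^ (m + 1) + ((m + 1 : ℕ) : ℝ) * v ^ m * (u - v) := by
    field_simp
    ring
  rw [h2] at h1
  rw [Nat.add_sub_cancel]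
  linarith

/-- The homogenization of `padePoly`. -/
def padeForm {R : Type*} [CommRing R] (r : ℕ) (ε : ℤ) (n : ℕ) (U V : R) : R :=
  ∑ k ∈ range (n + 1), (padeCoeff r ε n k : R) * U ^ k * V ^ (n - k)

theorem padeForm_eq_pow_mul_eval (r : ℕ) (ε : ℤ) (n : ℕ) (U : ℝ) {V : ℝ} (hV : V ≠ 0) :
    padeForm r ε n U V = V ^ n * (padePoly r ε n).eval (U / V) := by
  rw [padeForm, eval_padePoly, mul_sum]
  refine sum_congr rfl fun k hk => ?_
  rw [div_pow, pow_sub₀ _ hV (by have := mem_range.1 hk; omega)]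
  field_simp

theorem cast_padeForm (r : ℕ) (ε : ℤ) (n : ℕ) (U V : ℤ) :
    ((padeForm r ε n U V : ℤ) : ℝ) = padeForm r ε n (U : ℝ) (V : ℝ) := by
  simp [padeForm]

theorem abs_padeForm_le {r : ℕ} (hr : 1 ≤ r) {ε : ℤ} (hε : |ε| ≤ 1) (n : ℕ) {U V M : ℝ}
    (hU : 0 ≤ U) (hV : 0 ≤ V) (hUM : U ≤ M) (hVM : V ≤ M) :
    |padeForm r ε n U V| ≤ (8 * r ^ 2 * M) ^ n := by
  have hM : 0 ≤ M := hU.trans hUM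
  have h := sum_abs_padeCoeff_le hr hε n
  have h' : ∑ k ∈ range (n + 1), |(padeCoeff r ε n k : ℝ)| ≤ (8 * r ^ 2) ^ n := by exact_mod_cast h
  calc _ ≤ ∑ k ∈ range (n + 1), |(padeCoeff r ε n k : ℝ)| * M ^ n := by
        refine (abs_sum_le_sum_abs _ _).trans (sum_le_sum fun k hk => ?_)
        have hk' := mem_range.1 hk
        rw [mul_assoc, abs_mul]
        refine mul_le_mul_of_nonneg_left ?_ (abs_nonneg _)
        rw [abs_of_nonneg (by positivity), ← Nat.add_sub_cancel' (by omega : k ≤ n), pow_add,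
          Nat.add_sub_cancel_left]
        gcongr
    _ = (∑ k ∈ range (n + 1), |(padeCoeff r ε n k : ℝ)|) * M ^ n := by rw [sum_mul]
    _ ≤ (8 * r ^ 2) ^ n * M ^ n := by gcongr
    _ = _ := by rw [← mul_pow]

theorem padeForm_cross_ne_zero {r : ℕ} (hr : 2 ≤ r) (n : ℕ) {U V : ℝ} (hV : V ≠ 0)
    (hUV : U ≠ V) :
    padeForm r 1 n U V * padeForm r (-1) (n + 1) U V
      - padeForm r 1 (n + 1) U V * padeForm r (-1) n U V ≠ 0 := by
  have h := eval_padeCross_ne_zero hr n (W := U / V) (by rwa [ne_eq, div_eq_one_iff_eq hV])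
  simp only [padeForm_eq_pow_mul_eval _ _ _ _ hV]
  have : V ^ n * (padePoly r 1 n).eval (U / V) * (V ^ (n + 1) * (padePoly r (-1) (n + 1)).eval (U / V))
      - V ^ (n + 1) * (padePoly r 1 (n + 1)).eval (U / V) * (V ^ n * (padePoly r (-1) n).eval (U / V))
      = V ^ n * V ^ (n + 1) * (padeCross r n).eval (U / V) := by
    simp only [padeCross, Polynomial.eval_sub, Polynomial.eval_mul]
    ring
  rw [this]
  exact mul_ne_zero (by positivity) h

theorem max_le_two_mul_min_of_abs_pow_sub_le {r : ℕ} (hr : 1 ≤ r) {u v c : ℝ} (hu : 0 < u)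
    (hv : 0 < v) (hc : |u ^ r - v ^ r| ≤ c) (hcs : c ≤ (min u v) ^ r) :
    u ≤ 2 * min u v ∧ v ≤ 2 * min u v := by
  have hs : 0 < min u v := lt_min hu hv
  obtain ⟨h1, h2⟩ := abs_le.1 hc
  have h3 : 2 * (min u v) ^ r ≤ (2 * min u v) ^ r := by
    rw [mul_pow]
    gcongr
    exact le_self_pow₀ (by norm_num) (by omega)
  have hmin : (min u v) ^ r = u ^ r ∨ (min u v) ^ r = v ^ r := by
    rcases min_choice u v with h | h <;> simp [h]
  have h4 : (min u v) ^ r ≤ u ^ r := pow_le_pow_left₀ hs.le (min_le_left _ _) r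
  have h5 : (min u v) ^ r ≤ v ^ r := pow_le_pow_left₀ hs.le (min_le_right _ _) r
  constructor <;> refine le_of_pow_le_pow_left₀ (by omega : r ≠ 0) (by positivity) ?_ <;>
    rcases hmin with h | h <;> linarith

theorem abs_padeForm_remainder_le {r : ℕ} (hr : 2 ≤ r) (n : ℕ) {u v s c : ℝ} (hu : 0 < u)
    (hv : 0 < v) (hs : s = min u v) (hc : |u ^ r - v ^ r| ≤ c) (hcs : c ≤ s ^ r) :
    |padeForm r 1 n (u ^ r) (v ^ r) * v - padeForm r (-1) n (u ^ r) (v ^ r) * u| ≤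
      4 * s * (4 * r ^ 2 * c ^ 2) ^ n * c / (r * (s ^ r) ^ (n + 1)) := by
  have hs0 : 0 < s := hs ▸ lt_min hu hv
  have hr0 : (0 : ℝ) < r := by positivity
  have hS : 0 < s ^ r := pow_pos hs0 r
  have hsu : s ^ r ≤ u ^ r := pow_le_pow_left₀ hs0.le (hs ▸ min_le_left _ _) r
  have hsv : s ^ r ≤ v ^ r := pow_le_pow_left₀ hs0.le (hs ▸ min_le_right _ _) r
  have hc0 : 0 ≤ c := (abs_nonneg _).trans hc
  obtain ⟨hc1, hc2⟩ := abs_le.1 hc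
  have hU : 0 < u ^ r := pow_pos hu r
  have hV : 0 < v ^ r := pow_pos hv r
  obtain ⟨-, hv2⟩ := max_le_two_mul_min_of_abs_pow_sub_le (by omega) hu hv hc (hs ▸ hcs)
  rw [← hs] at hv2
  have hmin : s ^ r = u ^ r ∨ s ^ r = v ^ r := by
    rcases min_choice u v with h | h <;> simp [hs, h]
  have hV2 : v ^ r ≤ 2 * s ^ r := by rcases hmin with h | h <;> linarith
  have hU2 : u ^ r ≤ 2 * v ^ r := by linarith
  set t := log (u / v) with ht
  have hw : exp t = u / v := exp_log (by positivity)
  have hrt : r * t = log (u ^ r / v ^ r) := by rw [← div_pow, log_pow]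
  have hW : exp (r * t) = u ^ r / v ^ r := by rw [hrt, exp_log (by positivity)]
  have hrem := abs_padePoly_remainder_le hr n t
  rw [hW, hw] at hrem
  -- The inequality log z ≤ z - 1 is applied to both W and 1/W.
  have htabs : |t| ≤ c / (r * s ^ r) := by
    have h1 : r * t ≤ c / s ^ r := by
      rw [hrt]
      refine (log_le_sub_one_of_pos (by positivity)).trans ?_
      rw [div_sub_one hV.ne']
      exact div_le_div₀ hc0 hc2 hS hsv
    have h2 : -(r * t) ≤ c / s ^ r := by
      rw [hrt, ← log_inv, inv_div]
      refine (log_le_sub_one_of_pos (by positivity)).trans ?_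
      rw [div_sub_one hU.ne']
      exact div_le_div₀ hc0 (by linarith) hS hsu
    have h3 : r * |t| ≤ c / s ^ r := by
      rw [show r * |t| = |r * t| by rw [abs_mul, abs_of_pos hr0]]
      exact abs_le'.2 ⟨h1, h2⟩
    rw [mul_comm (r : ℝ), ← div_div, le_div_iff₀ hr0]
    linarith
  -- For t ≥ 0, rn + 1 ≤ (n + 1)r and exp (r t) = W ≤ 2.
  have hexp : exp ((r * n + 1) * max t 0) ≤ 2 ^ (n + 1) := by
    rcases le_total t 0 with h | h
    · rw [max_eq_right h, mul_zero, exp_zero]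
      exact one_le_pow₀ (by norm_num)
    · rw [max_eq_left h]
      have hr1 : (1 : ℝ) ≤ r := by exact_mod_cast (by omega : 1 ≤ r)
      calc exp ((r * n + 1) * t) ≤ exp ((n + 1 : ℕ) * (r * t)) := by
            apply exp_le_exp.2
            push_cast
            nlinarith [mul_le_mul_of_nonneg_right hr1 h]
        _ = (u ^ r / v ^ r) ^ (n + 1) := by rw [exp_nat_mul, hW]
        _ ≤ _ := pow_le_pow_left₀ (by positivity) ((div_le_iff₀ hV).2 hU2) _
  have key : padeForm r 1 n (u ^ r) (v ^ r) * v - padeForm r (-1) n (u ^ r) (v ^ r) * u =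
      v * (v ^ r) ^ n * ((padePoly r 1 n).eval (u ^ r / v ^ r) -
        u / v * (padePoly r (-1) n).eval (u ^ r / v ^ r)) := by
    rw [padeForm_eq_pow_mul_eval _ _ _ _ hV.ne', padeForm_eq_pow_mul_eval _ _ _ _ hV.ne']
    field_simp
  rw [key, abs_mul, abs_of_pos (by positivity : 0 < v * (v ^ r) ^ n)]
  calc _ ≤ 2 * s * (2 * s ^ r) ^ n * ((r : ℝ) ^ (4 * n) * (c / (r * s ^ r)) ^ (2 * n + 1) *
        2 ^ (n + 1)) := by
        gcongr
        refine hrem.trans ?_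
        gcongr
    _ = _ := by
        have e1 : (2 * s ^ r) ^ n = 2 ^ n * (s ^ r) ^ n := mul_pow _ _ _
        have e2 : (4 * (r : ℝ) ^ 2 * c ^ 2) ^ n = 2 ^ n * 2 ^ n * r ^ (2 * n) * c ^ (2 * n) := by
          rw [mul_pow, mul_pow, ← pow_mul, ← pow_mul, ← mul_pow]; norm_num
        rw [e1, e2, div_pow, mul_pow (r : ℝ), pow_succ c, pow_succ (r : ℝ), pow_succ (s ^ r) n,
          show (s ^ r) ^ (2 * n + 1) = (s ^ r) ^ n * ((s ^ r) ^ n * s ^ r) by ring,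
          show (r : ℝ) ^ (4 * n) = r ^ (2 * n) * r ^ (2 * n) by ring, pow_succ (2 : ℝ)]
        field_simp
        ring

theorem abs_padeForm_pair_le {r : ℕ} (hr : 2 ≤ r) (n : ℕ) {u v s u' v' s' c : ℝ}
    (hu : 0 < u) (hv : 0 < v) (hs : s = min u v) (hc : |u ^ r - v ^ r| ≤ c) (hcs : c ≤ s ^ r)
    (hu' : 0 < u') (hv' : 0 < v') (hs' : s' = min u' v') (hc' : |u' ^ r - v' ^ r| ≤ c)
    (hcs' : c ≤ s' ^ r) :
    |padeForm r 1 n (u ^ r) (v ^ r) * (v * u') - padeForm r (-1) n (u ^ r) (v ^ r) * (u * v')| ≤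
      8 * s * s' * (4 * r ^ 2 * c ^ 2) ^ n * c / (r * (s ^ r) ^ (n + 1)) +
        (16 * r ^ 2 * s ^ r) ^ n * (2 * s * c) / (r * s' ^ (r - 1)) := by
  have hs0 : 0 < s := hs ▸ lt_min hu hv
  have hc0 : 0 ≤ c := (abs_nonneg _).trans hc
  have hs0' : 0 < s' := hs' ▸ lt_min hu' hv'
  have hr0 : (0 : ℝ) < r := by positivity
  have h1 := abs_padeForm_remainder_le hr n hu hv hs hc hcs
  obtain ⟨hu2, hv2⟩ := max_le_two_mul_min_of_abs_pow_sub_le (by omega) hu hv hc (hs ▸ hcs)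
  obtain ⟨-, hv2'⟩ := max_le_two_mul_min_of_abs_pow_sub_le (by omega) hu' hv' hc' (hs' ▸ hcs')
  rw [← hs] at hu2 hv2
  rw [← hs'] at hv2'
  have hmin : s ^ r = u ^ r ∨ s ^ r = v ^ r := by
    rcases min_choice u v with h | h <;> simp [hs, h]
  have hsu : s ^ r ≤ u ^ r := pow_le_pow_left₀ hs0.le (hs ▸ min_le_left _ _) r
  have hsv : s ^ r ≤ v ^ r := pow_le_pow_left₀ hs0.le (hs ▸ min_le_right _ _) r
  obtain ⟨hc1, hc2⟩ := abs_le.1 hc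
  have hU2 : u ^ r ≤ 2 * s ^ r := by rcases hmin with h | h <;> linarith
  have hV2 : v ^ r ≤ 2 * s ^ r := by rcases hmin with h | h <;> linarith
  have h2 := abs_padeForm_le (by omega : 1 ≤ r) (ε := 1) (by simp) n
    (pow_pos hu r).le (pow_pos hv r).le hU2 hV2
  have h3 : |u' - v'| ≤ c / (r * s' ^ (r - 1)) := by
    rw [le_div_iff₀ (by positivity), mul_comm, hs']
    exact (mul_pow_mul_abs_sub_le (by omega) hu' hv').trans hc'
  have key : padeForm r 1 n (u ^ r) (v ^ r) * (v * u') - padeForm r (-1) n (u ^ r) (v ^ r) * (u * v')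
      = (padeForm r 1 n (u ^ r) (v ^ r) * v - padeForm r (-1) n (u ^ r) (v ^ r) * u) * v' +
        padeForm r 1 n (u ^ r) (v ^ r) * v * (u' - v') := by ring
  rw [key]
  refine (abs_add_le _ _).trans ?_
  rw [abs_mul, abs_mul, abs_mul, abs_of_pos hv, abs_of_pos hv']
  calc _ ≤ (4 * s * (4 * r ^ 2 * c ^ 2) ^ n * c / (r * (s ^ r) ^ (n + 1))) * (2 * s') +
        (8 * r ^ 2 * (2 * s ^ r)) ^ n * (2 * s) * (c / (r * s' ^ (r - 1))) := by
        gcongr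
    _ = _ := by
        rw [show (8 : ℝ) * r ^ 2 * (2 * s ^ r) = 16 * r ^ 2 * s ^ r by ring]
        ring

/-! ### Consequences of the upper bound: gap and bootstrap -/

/-- The bound for the absolute value of a nonzero Padé form in two approximations of sizes
`s` and `s'`. -/
noncomputable def padeBound (r n : ℕ) (s s' c : ℝ) : ℝ :=
  8 * s * s' * (4 * r ^ 2 * c ^ 2) ^ n * c / (r * (s ^ r) ^ (n + 1)) +
    (16 * r ^ 2 * s ^ r) ^ n * (2 * s * c) / (r * s' ^ (r - 1))

theorem mul_le_of_le_padeBound_zero {r : ℕ} (hr : 5 ≤ r) {s s' c D : ℝ} (hs : 0 < s) (hss : s ≤ s')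
    (hc : 0 ≤ c) (h : D ≤ padeBound r 0 s s' c) : D * s ^ r ≤ 2 * c * s * s' := by
  have hs' : 0 < s' := hs.trans_le hss
  have hr5 : (5 : ℝ) ≤ r := by exact_mod_cast hr
  have hr0 : (0 : ℝ) < r := by linarith
  obtain ⟨m, rfl⟩ := Nat.exists_eq_add_of_le' (by omega : 1 ≤ r)
  have h1 : 2 * s * c / (((m + 1 : ℕ) : ℝ) * s' ^ m) ≤
      2 * s * s' * c / (((m + 1 : ℕ) : ℝ) * s ^ (m + 1)) := by
    rw [div_le_div_iff₀ (by positivity) (by positivity)]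
    calc 2 * s * c * (((m + 1 : ℕ) : ℝ) * s ^ (m + 1))
        = 2 * s * c * ((m + 1 : ℕ) : ℝ) * (s ^ m * s) := by ring
      _ ≤ 2 * s * c * ((m + 1 : ℕ) : ℝ) * (s' ^ m * s') := by gcongr
      _ = _ := by ring
  have h2 : D ≤ 10 * s * s' * c / (((m + 1 : ℕ) : ℝ) * s ^ (m + 1)) := by
    simp only [padeBound, pow_zero, mul_one, zero_add, pow_one, one_mul, Nat.add_sub_cancel] at h
    calc D ≤ _ := h
      _ ≤ 8 * s * s' * c / (((m + 1 : ℕ) : ℝ) * s ^ (m + 1)) +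
          2 * s * s' * c / (((m + 1 : ℕ) : ℝ) * s ^ (m + 1)) := by gcongr
      _ = _ := by rw [← add_div]; ring_nf
  rw [le_div_iff₀ (by positivity)] at h2
  by_cases hD : 0 ≤ D
  · have : 5 * (D * s ^ (m + 1)) ≤ ((m + 1 : ℕ) : ℝ) * (D * s ^ (m + 1)) := by gcongr
    linarith
  · have : D * s ^ (m + 1) ≤ 0 := mul_nonpos_of_nonpos_of_nonneg (by linarith) (by positivity)
    have : 0 ≤ 2 * c * s * s' := by positivity
    linarith

/-- A lower bound for the size `s'` of the second approximation, from the `n`-th Padé form. -/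
theorem pow_succ_le_of_le_padeBound {r n : ℕ} (hr : 5 ≤ r) {s s' c D : ℝ} (hs : 0 < s)
    (hs' : 0 < s') (hc : 1 ≤ c) (hD : 1 ≤ D) (h : D ≤ padeBound r n s s' c)
    (hsmall : 4 * c * s * (16 * r ^ 2 * s ^ r) ^ n ≤ s' ^ (r - 1)) :
    (s ^ r) ^ (n + 1) ≤ 16 * c * s * s' * (16 * r ^ 2 * c ^ 2) ^ n := by
  have hr5 : (5 : ℝ) ≤ r := by exact_mod_cast hr
  have hr0 : (0 : ℝ) < r := by linarith
  have h1 : (16 * r ^ 2 * s ^ r) ^ n * (2 * s * c) / (r * s' ^ (r - 1)) ≤ 1 / 2 := by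
    rw [div_le_div_iff₀ (by positivity) (by norm_num)]
    have : 1 * s' ^ (r - 1) ≤ r * s' ^ (r - 1) := by gcongr; linarith
    linarith
  have h2 : 1 / 2 ≤ 8 * s * s' * (4 * r ^ 2 * c ^ 2) ^ n * c / (r * (s ^ r) ^ (n + 1)) := by
    rw [padeBound] at h; linarith
  rw [div_le_div_iff₀ (by norm_num) (by positivity)] at h2
  have h3 : 1 * (s ^ r) ^ (n + 1) ≤ r * (s ^ r) ^ (n + 1) := by gcongr; linarith
  calc (s ^ r) ^ (n + 1) ≤ 16 * c * s * s' * (4 * r ^ 2 * c ^ 2) ^ n := by linarith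
    _ ≤ _ := by gcongr; norm_num

/-- The bound at index n forces s' to be so large that the second term of `padeBound` is harmless at
indices up to n + 2. That reach is needed because the form of index n + 1 may vanish. -/
theorem small_of_pow_succ_le {r n m : ℕ} (hr : 5 ≤ r) (hm : m ≤ n + 2) {s s' c : ℝ} (hs : 0 < s)
    (hc : 1 ≤ c) (hS : (16 * r ^ 2 * c ^ 2) ^ 7 ≤ s ^ r)
    (h : (s ^ r) ^ (n + 1) ≤ 16 * c * s * s' * (16 * r ^ 2 * c ^ 2) ^ n) :
    4 * c * s * (16 * r ^ 2 * s ^ r) ^ m ≤ s' ^ (r - 1) := by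
  have hr5 : (5 : ℝ) ≤ r := by exact_mod_cast hr
  obtain ⟨q, hq⟩ := Nat.exists_eq_add_of_le' hr
  set K : ℝ := 16 * r ^ 2 * c ^ 2 with hK
  set S : ℝ := s ^ r with hSdef
  have hr2 : (25 : ℝ) ≤ r ^ 2 := by nlinarith
  have hcc : c ≤ c ^ 2 := by nlinarith
  have hK1 : 16 * (r : ℝ) ^ 2 ≤ K := by
    rw [hK]; exact le_mul_of_one_le_right (by positivity) (one_le_pow₀ hc)
  have hK2 : 16 * c ≤ K := by
    rw [hK]
    calc 16 * c ≤ 16 * c ^ 2 := by linarith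
      _ ≤ 16 * r ^ 2 * c ^ 2 := by gcongr; linarith
  have hK0 : 1 ≤ K := by linarith
  have hS1 : 1 ≤ S := (one_le_pow₀ hK0).trans hS
  have hpow : (S ^ (n + 1)) ^ (r - 1) * s ≤ (16 * c * K ^ n) ^ (r - 1) * S * s' ^ (r - 1) := by
    have := pow_le_pow_left₀ (by positivity) h (r - 1)
    calc _ ≤ (16 * c * s * s' * K ^ n) ^ (r - 1) * s := by gcongr
      _ = (16 * c * K ^ n) ^ (r - 1) * (s ^ (r - 1) * s) * s' ^ (r - 1) := by
        rw [show 16 * c * s * s' * K ^ n = 16 * c * K ^ n * s * s' by ring, mul_pow, mul_pow]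
        ring
      _ = _ := by rw [← pow_succ, Nat.sub_add_cancel (by omega)]
  have hmain : 4 * c * (16 * r ^ 2 * S) ^ m * ((16 * c * K ^ n) ^ (r - 1) * S) ≤
      (S ^ (n + 1)) ^ (r - 1) := by
    have e1 : 1 ≤ 16 * (r : ℝ) ^ 2 * S := one_le_mul_of_one_le_of_one_le (by linarith) hS1
    -- The exponent 7 in K^7 ≤ S originates here: r + 2 ≤ 7(r - 4) holds exactly for r ≥ 5, with
    -- equality at r = 5.
    have e2 : K ^ (r + 2 + n * r) ≤ S ^ ((r - 4) + n * (r - 2)) := by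
      calc K ^ (r + 2 + n * r) ≤ K ^ (7 * ((r - 4) + n * (r - 2))) := by
            apply pow_le_pow_right₀ hK0
            subst hq
            rw [show q + 5 - 4 = q + 1 by omega, show q + 5 - 2 = q + 3 by omega]
            nlinarith [Nat.zero_le (n * q)]
        _ = (K ^ 7) ^ ((r - 4) + n * (r - 2)) := by rw [pow_mul]
        _ ≤ _ := by gcongr
    calc _ ≤ K * (K * S) ^ (n + 2) * ((K * K ^ n) ^ (r - 1) * S) := by
          gcongr
          · linarith
          · calc (16 * (r : ℝ) ^ 2 * S) ^ m ≤ (16 * (r : ℝ) ^ 2 * S) ^ (n + 2) :=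
                pow_le_pow_right₀ e1 hm
              _ ≤ _ := by gcongr
      _ = K ^ (r + 2 + n * r) * S ^ (n + 3) := by
          subst hq
          rw [show q + 5 - 1 = q + 4 by omega]
          ring
      _ ≤ S ^ ((r - 4) + n * (r - 2)) * S ^ (n + 3) := by gcongr
      _ = _ := by
          subst hq
          rw [show q + 5 - 1 = q + 4 by omega, show q + 5 - 4 = q + 1 by omega,
            show q + 5 - 2 = q + 3 by omega]
          ring
  have hpos : 0 < (16 * c * K ^ n) ^ (r - 1) * S := by positivity
  refine le_of_mul_le_mul_right ?_ hpos
  calc _ = 4 * c * (16 * r ^ 2 * S) ^ m * ((16 * c * K ^ n) ^ (r - 1) * S) * s := by ring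
    _ ≤ (S ^ (n + 1)) ^ (r - 1) * s := by gcongr
    _ ≤ _ := hpow
    _ = _ := by ring

/-- Induction produces the bound S^(m+1) ≤ 16 c s s' K^m for arbitrarily large m. As S ≥ 2K, it
gives 2^m ≤ 16 c s s', whose right side is fixed. -/
theorem false_of_le_padeBound {r : ℕ} (hr : 5 ≤ r) {s s' c D : ℝ} (hs : 0 < s) (hs' : 0 < s')
    (hc : 1 ≤ c) (hD : 1 ≤ D) (hS : (16 * r ^ 2 * c ^ 2) ^ 7 ≤ s ^ r)
    (h0 : s ^ r ≤ 16 * c * s * s')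
    (h : ∀ n, D ≤ padeBound r n s s' c ∨ D ≤ padeBound r (n + 1) s s' c) : False := by
  have hr5 : (5 : ℝ) ≤ r := by exact_mod_cast hr
  set K : ℝ := 16 * r ^ 2 * c ^ 2 with hK
  have hK2 : 2 ≤ K := by
    have : (25 : ℝ) ≤ r ^ 2 := by nlinarith
    have : (1 : ℝ) ≤ c ^ 2 := one_le_pow₀ hc
    rw [hK]
    nlinarith
  have step : ∀ n, ∃ m, n ≤ m ∧ (s ^ r) ^ (m + 1) ≤ 16 * c * s * s' * K ^ m := by
    intro n
    induction n with
    | zero => exact ⟨0, le_rfl, by simpa using h0⟩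
    | succ n ih =>
      obtain ⟨m, hm, hle⟩ := ih
      rcases h (m + 1) with h | h
      · exact ⟨m + 1, by omega, pow_succ_le_of_le_padeBound hr hs hs' hc hD h
          (small_of_pow_succ_le hr (by omega) hs hc hS hle)⟩
      · exact ⟨m + 2, by omega, pow_succ_le_of_le_padeBound hr hs hs' hc hD h
          (small_of_pow_succ_le hr (by omega) hs hc hS hle)⟩
  obtain ⟨n, hn⟩ := pow_unbounded_of_one_lt (16 * c * s * s') (one_lt_two (α := ℝ))
  obtain ⟨m, hm, hle⟩ := step n
  have hKS : 2 * K ≤ s ^ r := by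
    calc 2 * K ≤ K * K := by gcongr
      _ = K ^ 2 := by ring
      _ ≤ K ^ 7 := pow_le_pow_right₀ (by linarith) (by norm_num)
      _ ≤ _ := hS
  have hS1 : 1 ≤ s ^ r := by linarith
  have : 2 ^ m * K ^ m ≤ 16 * c * s * s' * K ^ m :=
    calc 2 ^ m * K ^ m = (2 * K) ^ m := (mul_pow _ _ _).symm
      _ ≤ (s ^ r) ^ m := by gcongr
      _ ≤ (s ^ r) ^ (m + 1) := pow_le_pow_right₀ hS1 (by omega)
      _ ≤ _ := hle
  have h2 := le_of_mul_le_mul_right this (by positivity)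
  have h3 : (2 : ℝ) ^ n ≤ 2 ^ m := pow_le_pow_right₀ (by norm_num) hm
  linarith

/-! ### Solutions, their sizes and the gap principle -/

/-- `(x, y)` is a coprime positive solution of `0 < |a x ^ r - b y ^ r| ≤ c`. -/
def IsSmallSolution (a b c r : ℕ) (p : ℕ × ℕ) : Prop :=
  0 < p.1 ∧ 0 < p.2 ∧ Nat.gcd p.1 p.2 = 1 ∧
    0 < |(a : ℤ) * (p.1 : ℤ) ^ r - (b : ℤ) * (p.2 : ℤ) ^ r| ∧
    |(a : ℤ) * (p.1 : ℤ) ^ r - (b : ℤ) * (p.2 : ℤ) ^ r| ≤ (c : ℤ)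

/-- The size of a pair `(x, y)`: the smaller of `a x ^ r` and `b y ^ r`. -/
def pairSize (a b r : ℕ) (p : ℕ × ℕ) : ℕ := min (a * p.1 ^ r) (b * p.2 ^ r)

/-- The integer obtained by evaluating the `n`-th Padé form of `p` at `p'`. -/
def padePairing (a b r n : ℕ) (p p' : ℕ × ℕ) : ℤ :=
  padeForm r 1 n ((a : ℤ) * (p.1 : ℤ) ^ r) ((b : ℤ) * (p.2 : ℤ) ^ r) * (p.2 * p'.1) -
    padeForm r (-1) n ((a : ℤ) * (p.1 : ℤ) ^ r) ((b : ℤ) * (p.2 : ℤ) ^ r) * (p.1 * p'.2)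

/-- At n = 0 the pairing is y x' - x y', which vanishes for coprime pairs only if they coincide. -/
theorem padePairing_zero_ne_zero {a b c r : ℕ} {p p' : ℕ × ℕ} (hp : IsSmallSolution a b c r p)
    (hp' : IsSmallSolution a b c r p') (hne : p ≠ p') : padePairing a b r 0 p p' ≠ 0 := by
  intro h
  simp only [padePairing, padeForm, padeCoeff, zero_add, range_one, sum_singleton, pow_zero,
    Nat.sub_self, range_zero, prod_empty, mul_one, Nat.factorial_zero, Nat.cast_one,
    Int.ediv_one, Int.cast_one, one_mul, sub_eq_zero] at h
  have h' : p.2 * p'.1 = p.1 * p'.2 := by exact_mod_cast h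
  have hd : p.1 ∣ p'.1 := (Nat.Coprime.dvd_mul_left hp.2.2.1).1 (h' ▸ dvd_mul_right _ _)
  have hd' : p'.1 ∣ p.1 := (Nat.Coprime.dvd_mul_right hp'.2.2.1).1 (h' ▸ dvd_mul_left _ _)
  have h1 : p.1 = p'.1 := Nat.dvd_antisymm hd hd'
  rw [← h1, mul_comm] at h'
  exact hne (Prod.ext h1 (Nat.eq_of_mul_eq_mul_left hp.1 h'))

/-- Two vanishing pairings would give a linear system with a nonzero solution, hence a zero cross
determinant. -/
theorem padePairing_ne_zero_or {a b c r : ℕ} (hb : 0 < b) (hr : 2 ≤ r) {p p' : ℕ × ℕ}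
    (hp : IsSmallSolution a b c r p) (hp' : IsSmallSolution a b c r p') (n : ℕ) :
    padePairing a b r n p p' ≠ 0 ∨ padePairing a b r (n + 1) p p' ≠ 0 := by
  by_contra! h
  obtain ⟨h1, h2⟩ := h
  have hy := hp.2.1
  have hx' := hp'.1
  have hU : (a : ℤ) * (p.1 : ℤ) ^ r ≠ (b : ℤ) * (p.2 : ℤ) ^ r := by
    intro h
    simpa [h] using hp.2.2.2.1
  have hV : (b : ℤ) * (p.2 : ℤ) ^ r ≠ 0 := by positivity
  have key := padeForm_cross_ne_zero hr n (U := (((a : ℤ) * (p.1 : ℤ) ^ r : ℤ) : ℝ))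
    (V := (((b : ℤ) * (p.2 : ℤ) ^ r : ℤ) : ℝ)) (by exact_mod_cast hV) (by exact_mod_cast hU)
  simp only [← cast_padeForm] at key
  simp only [padePairing, sub_eq_zero] at h1 h2
  apply key
  norm_cast
  have hX : ((p.2 * p'.1 : ℕ) : ℤ) ≠ 0 := by positivity
  refine (mul_eq_zero.1 ?_).resolve_right hX
  push_cast at h1 h2 ⊢
  linear_combination (padeForm r (-1) (n + 1) ((a : ℤ) * (p.1 : ℤ) ^ r) ((b : ℤ) * (p.2 : ℤ) ^ r)) * h1
    - (padeForm r (-1) n ((a : ℤ) * (p.1 : ℤ) ^ r) ((b : ℤ) * (p.2 : ℤ) ^ r)) * h2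

theorem le_padeBound_of_padePairing_ne_zero {a b c r : ℕ} (ha : 0 < a) (hb : 0 < b) (hr : 2 ≤ r)
    {p p' : ℕ × ℕ} (hp : IsSmallSolution a b c r p) (hp' : IsSmallSolution a b c r p')
    (hcp : c ≤ pairSize a b r p) (hcp' : c ≤ pairSize a b r p') {n : ℕ}
    (h : padePairing a b r n p p' ≠ 0) :
    ((a * b : ℕ) : ℝ) ^ (r : ℝ)⁻¹ ≤ padeBound r n ((pairSize a b r p : ℝ) ^ (r : ℝ)⁻¹)
      ((pairSize a b r p' : ℝ) ^ (r : ℝ)⁻¹) c := by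
  have hr0 : r ≠ 0 := by omega
  set α : ℝ := (a : ℝ) ^ (r : ℝ)⁻¹ with hα
  set β : ℝ := (b : ℝ) ^ (r : ℝ)⁻¹ with hβ
  have hα0 : 0 < α := by positivity
  have hβ0 : 0 < β := by positivity
  have hαr : α ^ r = a := rpow_inv_natCast_pow (by positivity) hr0
  have hβr : β ^ r = b := rpow_inv_natCast_pow (by positivity) hr0
  have hD : ((a * b : ℕ) : ℝ) ^ (r : ℝ)⁻¹ = α * β := by
    rw [Nat.cast_mul, mul_rpow (by positivity) (by positivity)]
  have hu : ∀ q : ℕ × ℕ, (α * q.1) ^ r = ((a * q.1 ^ r : ℕ) : ℝ) := fun q => by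
    rw [mul_pow, hαr]; push_cast; rfl
  have hv : ∀ q : ℕ × ℕ, (β * q.2) ^ r = ((b * q.2 ^ r : ℕ) : ℝ) := fun q => by
    rw [mul_pow, hβr]; push_cast; rfl
  have hsize : ∀ q : ℕ × ℕ, (pairSize a b r q : ℝ) ^ (r : ℝ)⁻¹ = min (α * q.1) (β * q.2) := by
    intro q
    have h1 : α * q.1 = ((a * q.1 ^ r : ℕ) : ℝ) ^ (r : ℝ)⁻¹ := by
      rw [← hu, pow_rpow_inv_natCast (by positivity) hr0]
    have h2 : β * q.2 = ((b * q.2 ^ r : ℕ) : ℝ) ^ (r : ℝ)⁻¹ := by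
      rw [← hv, pow_rpow_inv_natCast (by positivity) hr0]
    have hm : Monotone fun m : ℕ => (m : ℝ) ^ (r : ℝ)⁻¹ := fun i j hij =>
      rpow_le_rpow (by positivity) (by exact_mod_cast hij) (by positivity)
    rw [h1, h2]
    exact hm.map_min
  have hsr : ∀ q : ℕ × ℕ, ((pairSize a b r q : ℝ) ^ (r : ℝ)⁻¹) ^ r = pairSize a b r q := fun q =>
    rpow_inv_natCast_pow (by positivity) hr0
  have habs : ∀ q : ℕ × ℕ, IsSmallSolution a b c r q → |(α * q.1) ^ r - (β * q.2) ^ r| ≤ c := by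
    intro q hq
    rw [hu, hv]
    have := hq.2.2.2.2
    exact_mod_cast this
  have hx := hp.1
  have hy := hp.2.1
  have hx' := hp'.1
  have hy' := hp'.2.1
  have main := abs_padeForm_pair_le hr n (u := α * p.1) (v := β * p.2) (u' := α * p'.1)
    (v' := β * p'.2) (by positivity) (by positivity) (hsize p) (habs p hp)
    (by rw [hsr]; exact_mod_cast hcp) (by positivity) (by positivity) (hsize p') (habs p' hp')
    (by rw [hsr]; exact_mod_cast hcp')
  rw [hD]
  refine le_trans ?_ main
  have key : padeForm r 1 n ((α * p.1) ^ r) ((β * p.2) ^ r) * (β * p.2 * (α * p'.1)) -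
      padeForm r (-1) n ((α * p.1) ^ r) ((β * p.2) ^ r) * (α * p.1 * (β * p'.2)) =
      α * β * ((padePairing a b r n p p' : ℤ) : ℝ) := by
    rw [padePairing]
    push_cast [cast_padeForm]
    rw [hu, hv]
    push_cast
    ring
  rw [key, abs_mul, abs_of_pos (mul_pos hα0 hβ0)]
  refine le_mul_of_one_le_right (by positivity) ?_
  exact_mod_cast Int.one_le_abs h

/-- Here ab ≤ UV ≤ S(S + c), while S < c would give S(S + c) < 2c^2 ≤ ab. -/
theorem le_pairSize_and_mul_le {a b c r : ℕ} (hr : 5 ≤ r) (hc : 0 < c)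
    (hab : 2 ^ r * r ^ 7 * c ^ 3 ≤ a * b) {p : ℕ × ℕ} (hp : IsSmallSolution a b c r p) :
    c ≤ pairSize a b r p ∧ a * b ≤ 2 * pairSize a b r p ^ 2 := by
  obtain ⟨hx, hy, -, -, hle⟩ := hp
  set U := a * p.1 ^ r with hU
  set V := b * p.2 ^ r with hV
  have hle' : |(U : ℤ) - V| ≤ c := by rw [hU, hV]; push_cast; exact hle
  have h1 : a * b ≤ U * V := by
    rw [hU, hV]
    exact Nat.mul_le_mul (Nat.le_mul_of_pos_right _ (by positivity))
      (Nat.le_mul_of_pos_right _ (by positivity))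
  obtain ⟨hl, hu⟩ := abs_le.1 hle'
  have h2 : U * V ≤ pairSize a b r p * (pairSize a b r p + c) := by
    rw [pairSize, ← hU, ← hV]
    rcases le_total U V with h | h
    · rw [min_eq_left h]; exact Nat.mul_le_mul_left _ (by omega)
    · rw [min_eq_right h, mul_comm]; exact Nat.mul_le_mul_left _ (by omega)
  have h3 : 2 * c ^ 2 ≤ a * b := by
    refine le_trans ?_ hab
    calc 2 * c ^ 2 = 2 ^ 1 * 1 ^ 7 * c ^ 2 := by ring
      _ ≤ _ := by gcongr <;> omega
  have h4 : c ≤ pairSize a b r p := by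
    by_contra! h
    have : pairSize a b r p * (pairSize a b r p + c) < c * (c + c) :=
      Nat.mul_lt_mul_of_lt_of_le h (by omega) (by omega)
    nlinarith
  exact ⟨h4, by nlinarith⟩

theorem mul_pairSize_le {a b c r : ℕ} (ha : 0 < a) (hb : 0 < b) (hc : 0 < c) (hr : 5 ≤ r)
    (hab : 2 ^ r * r ^ 7 * c ^ 3 ≤ a * b) {p p' : ℕ × ℕ} (hp : IsSmallSolution a b c r p)
    (hp' : IsSmallSolution a b c r p') (hne : p ≠ p')
    (hle : pairSize a b r p ≤ pairSize a b r p') :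
    ((a * b : ℕ) : ℝ) ^ (r : ℝ)⁻¹ * pairSize a b r p ≤
      2 * c * (pairSize a b r p : ℝ) ^ (r : ℝ)⁻¹ * (pairSize a b r p' : ℝ) ^ (r : ℝ)⁻¹ := by
  have hcp := (le_pairSize_and_mul_le hr hc hab hp).1
  have hcp' := (le_pairSize_and_mul_le hr hc hab hp').1
  have h := le_padeBound_of_padePairing_ne_zero ha hb (by omega) hp hp' hcp hcp'
    (padePairing_zero_ne_zero hp hp' hne)
  have hpos : 0 < pairSize a b r p := by omega
  have := mul_le_of_le_padeBound_zero hr (by positivity)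
    (rpow_le_rpow (by positivity) (by exact_mod_cast hle) (by positivity)) (by positivity) h
  rwa [rpow_inv_natCast_pow (by positivity) (by omega)] at this

theorem pairSize_pow_four_le {a b c r : ℕ} (ha : 0 < a) (hb : 0 < b) (hc : 0 < c) (hr : 5 ≤ r)
    (hab : 2 ^ r * r ^ 7 * c ^ 3 ≤ a * b) {p p' : ℕ × ℕ} (hp : IsSmallSolution a b c r p)
    (hp' : IsSmallSolution a b c r p') (hne : p ≠ p')
    (hle : pairSize a b r p ≤ pairSize a b r p') :
    pairSize a b r p ^ 4 ≤ c ^ 2 * pairSize a b r p' := by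
  have h := mul_pairSize_le ha hb hc hr hab hp hp' hne hle
  have hcp := (le_pairSize_and_mul_le hr hc hab hp).1
  set S := pairSize a b r p
  set S' := pairSize a b r p'
  have h1 := pow_le_pow_left₀ (by positivity) h r
  rw [mul_pow, mul_pow, mul_pow, rpow_inv_natCast_pow (by positivity) (by omega),
    rpow_inv_natCast_pow (by positivity) (by omega),
    rpow_inv_natCast_pow (by positivity) (by omega)] at h1
  have h2 : a * b * S ^ r ≤ (2 * c) ^ r * S * S' := by exact_mod_cast h1
  have hS : 0 < S := by omega
  obtain ⟨q, rfl⟩ := Nat.exists_eq_add_of_le' hr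
  -- With r = q + 5, the lower bound for ab cancels 2^r and c^3, and c^q ≤ S^q handles the remaining
  -- powers of c.
  have h3 : (2 ^ (q + 5) * c ^ (q + 3) * S) * S ^ 4 ≤ (2 ^ (q + 5) * c ^ (q + 3) * S) * (c ^ 2 * S') := by
    calc _ = 2 ^ (q + 5) * 1 ^ 7 * c ^ 3 * (c ^ q * S ^ 5) := by ring
      _ ≤ 2 ^ (q + 5) * (q + 5) ^ 7 * c ^ 3 * (S ^ q * S ^ 5) := by gcongr; omega
      _ ≤ a * b * (S ^ q * S ^ 5) := by gcongr
      _ = a * b * S ^ (q + 5) := by ring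
      _ ≤ _ := h2
      _ = _ := by ring
  exact Nat.le_of_mul_le_mul_left h3 (by positivity)

/-! ### Ordering the solutions and counting -/

/-- Peels off a solution of least size. The clause in m is vacuous for n = 0, so the last of four
extractions uses the same statement. -/
theorem exists_min_of_lt_encard {α : Type*} {s : Set α} (f : α → ℕ) {n : ℕ}
    (h : (n : ℕ∞) < s.encard) :
    ∃ p ∈ s, (∀ q ∈ s, f p ≤ f q) ∧ ∀ m : ℕ, m + 1 = n → (m : ℕ∞) < (s \ {p}).encard := by
  have hne : s.Nonempty := Set.encard_pos.1 (lt_of_le_of_lt (zero_le) h)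
  obtain ⟨p, hp, hmin⟩ := exists_minimalFor_of_wellFoundedLT (· ∈ s) f hne
  refine ⟨p, hp, fun q hq => ?_, fun m hm => ?_⟩
  · by_contra! hlt
    exact absurd (hmin hq hlt.le) (by omega)
  · rw [← Set.encard_sdiff_singleton_add_one hp, ← hm, Nat.cast_add, Nat.cast_one] at h
    exact lt_of_add_lt_add_right h

theorem encard_isSmallSolution_le {a b c r : ℕ} (ha : 0 < a) (hb : 0 < b) (hc : 0 < c)
    (hr : 5 ≤ r) (hab : 2 ^ r * r ^ 7 * c ^ 3 ≤ a * b) :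
    {p : ℕ × ℕ | IsSmallSolution a b c r p}.encard ≤ 3 := by
  by_contra! hcard
  obtain ⟨p₁, hp₁, hmin₁, hcard⟩ := exists_min_of_lt_encard (pairSize a b r) (n := 3) hcard
  obtain ⟨p₂, hp₂, hmin₂, hcard⟩ := exists_min_of_lt_encard (pairSize a b r) (hcard 2 rfl)
  obtain ⟨p₃, hp₃, hmin₃, hcard⟩ := exists_min_of_lt_encard (pairSize a b r) (hcard 1 rfl)
  obtain ⟨p₄, hp₄, -, -⟩ := exists_min_of_lt_encard (pairSize a b r) (hcard 0 rfl)
  have g₁ := pairSize_pow_four_le ha hb hc hr hab hp₁ hp₂.1 (Ne.symm hp₂.2) (hmin₁ _ hp₂.1)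
  have g₂ := pairSize_pow_four_le ha hb hc hr hab hp₂.1 hp₃.1.1 (Ne.symm hp₃.2) (hmin₂ _ hp₃.1)
  have g₃ := mul_pairSize_le ha hb hc hr hab hp₃.1.1 hp₄.1.1.1 (Ne.symm hp₄.2) (hmin₃ _ hp₄.1)
  have hsq := (le_pairSize_and_mul_le hr hc hab hp₁).2
  have hc₃ := (le_pairSize_and_mul_le hr hc hab hp₃.1.1).1
  have hc₄ := (le_pairSize_and_mul_le hr hc hab hp₄.1.1.1).1
  have hlarge : (16 * r ^ 2 * c ^ 2) ^ 7 ≤ pairSize a b r p₃ := by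
    have e1 : 2 ^ 4 * r ^ 7 * c ^ 3 ≤ pairSize a b r p₁ ^ 2 := by
      have h5 : 2 ^ 5 * r ^ 7 * c ^ 3 ≤ 2 ^ r * r ^ 7 * c ^ 3 := by gcongr; norm_num
      have := h5.trans (hab.trans hsq)
      linarith
    -- Two applications of the gap principle give S₁^16 ≤ c^10 S₃, and S₁^2 ≥ 2^4 r^7 c^3.
    refine le_of_mul_le_mul_left (a := c ^ 10) ?_ (by positivity)
    calc c ^ 10 * (16 * r ^ 2 * c ^ 2) ^ 7 = 2 ^ 28 * r ^ 14 * c ^ 24 := by ring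
      _ ≤ 2 ^ 32 * r ^ 56 * c ^ 24 := by gcongr <;> omega
      _ = (2 ^ 4 * r ^ 7 * c ^ 3) ^ 8 := by ring
      _ ≤ (pairSize a b r p₁ ^ 2) ^ 8 := by gcongr
      _ = (pairSize a b r p₁ ^ 4) ^ 4 := by ring
      _ ≤ (c ^ 2 * pairSize a b r p₂) ^ 4 := by gcongr
      _ = c ^ 8 * pairSize a b r p₂ ^ 4 := by ring
      _ ≤ c ^ 8 * (c ^ 2 * pairSize a b r p₃) := by gcongr
      _ = _ := by ring
  have hD : 1 ≤ ((a * b : ℕ) : ℝ) ^ (r : ℝ)⁻¹ :=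
    one_le_rpow (by exact_mod_cast Nat.mul_pos ha hb) (by positivity)
  have hS₃ : 0 < pairSize a b r p₃ := by omega
  have hS₄ : 0 < pairSize a b r p₄ := by omega
  have hroot : ((pairSize a b r p₃ : ℝ) ^ (r : ℝ)⁻¹) ^ r = pairSize a b r p₃ :=
    rpow_inv_natCast_pow (by positivity) (by omega)
  refine false_of_le_padeBound hr (s := (pairSize a b r p₃ : ℝ) ^ (r : ℝ)⁻¹)
    (s' := (pairSize a b r p₄ : ℝ) ^ (r : ℝ)⁻¹) (c := c) (by positivity) (by positivity)
    (by exact_mod_cast hc) hD (by rw [hroot]; exact_mod_cast hlarge) ?_ fun n => ?_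
  · rw [hroot]
    have h1 : 1 * (pairSize a b r p₃ : ℝ) ≤
        ((a * b : ℕ) : ℝ) ^ (r : ℝ)⁻¹ * pairSize a b r p₃ := by gcongr
    have h2 : 0 ≤ (c : ℝ) * (pairSize a b r p₃ : ℝ) ^ (r : ℝ)⁻¹ *
        (pairSize a b r p₄ : ℝ) ^ (r : ℝ)⁻¹ := by positivity
    linarith
  · exact (padePairing_ne_zero_or hb (by omega) hp₃.1.1 hp₄.1.1.1 n).imp
      (le_padeBound_of_padePairing_ne_zero ha hb (by omega) hp₃.1.1 hp₄.1.1.1 hc₃ hc₄)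
      (le_padeBound_of_padePairing_ne_zero ha hb (by omega) hp₃.1.1 hp₄.1.1.1 hc₃ hc₄)

theorem theorem1p1 (a b c r : ℕ) (ha : 0 < a) (hb : 0 < b) (hc : 0 < c) (hr : 5 ≤ r)
    (hab : (2 : ℝ) ^ r * (r : ℝ) ^ (7 * (r : ℝ) / ((r : ℝ) - 4)) *
        (c : ℝ) ^ (2 + ((r : ℝ) ^ 2 + (r : ℝ) + 2) / ((r : ℝ) * ((r : ℝ) - 4)))
      ≤ (a : ℝ) * (b : ℝ)) :
    {p : ℕ × ℕ | 0 < p.1 ∧ 0 < p.2 ∧ Nat.gcd p.1 p.2 = 1 ∧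
        0 < |(a : ℤ) * (p.1 : ℤ) ^ r - (b : ℤ) * (p.2 : ℤ) ^ r| ∧
        |(a : ℤ) * (p.1 : ℤ) ^ r - (b : ℤ) * (p.2 : ℤ) ^ r| ≤ (c : ℤ)}.encard ≤ 3 := by
  -- Only ab ≥ 2^r r^7 c^3 is needed: 7r/(r - 4) ≥ 7, and the fraction in the exponent of c is at
  -- least 1.
  refine encard_isSmallSolution_le ha hb hc hr ?_
  have hr5 : (5 : ℝ) ≤ r := by exact_mod_cast hr
  have hc1 : (1 : ℝ) ≤ c := by exact_mod_cast hc
  have h1 : (r : ℝ) ^ 7 ≤ (r : ℝ) ^ (7 * (r : ℝ) / ((r : ℝ) - 4)) := by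
    rw [← rpow_natCast]
    apply rpow_le_rpow_of_exponent_le (by linarith)
    rw [le_div_iff₀ (by linarith)]
    push_cast
    linarith
  have h2 : (c : ℝ) ^ 3 ≤
      (c : ℝ) ^ (2 + ((r : ℝ) ^ 2 + (r : ℝ) + 2) / ((r : ℝ) * ((r : ℝ) - 4))) := by
    rw [← rpow_natCast]
    apply rpow_le_rpow_of_exponent_le hc1
    have : 1 ≤ ((r : ℝ) ^ 2 + (r : ℝ) + 2) / ((r : ℝ) * ((r : ℝ) - 4)) := by
      rw [le_div_iff₀ (mul_pos (by linarith) (by linarith))]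
      nlinarith
    push_cast
    linarith
  have h3 : (2 : ℝ) ^ r * (r : ℝ) ^ 7 * (c : ℝ) ^ 3 ≤ (a : ℝ) * b :=
    le_trans (by gcongr) hab
  exact_mod_cast h3
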